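/- Let $p_\theta(x)=h(x)\exp(\theta T(x)-A(\theta))$, $\theta\in\mathbb R$, be a one-parameter exponential family of probability densities with respect to a measure $\mu$, where $h\ge 0$ and $A:\mathbb R\to\mathbb R$ is convex and differentiable; let $P_\theta$ be the distribution with density $p_\theta$. Let $\Theta_0,\Theta_1\subseteq\mathbb R$ be disjoint, $\mathcal P_j=\{P_\theta:\theta\in\Theta_j\}$, $\theta_1\in\Theta_1$ and $P_1=P_{\theta_1}$. Assume that either $\Theta_0$ has a smallest element $\theta^*$ and $\theta^*>\theta_1$, or $\Theta_0$ has a largest element $\theta^*$ and $\theta^*<\theta_1$. *Reverse information projection.* An e-variable for $\mathcal P_0$ is a measurable $B\ge 0$ with $\mathbb E_P[B]\le 1$ for all $P\in\mathcal P_0$. The numeraire for $P_\theta$ is the ($P_\theta$-a.s. unique) $P_\theta$-a.s. positive e-variable $B^*$ with $\mathbb E_{P_\theta}[B/B^*]\le 1$ for every e-variable $B$, and the RIPr of $P_\theta$ on $\mathcal P_0$ is the measure with density $1/B^*$ with respect to $P_\theta$. If the RIPr is some $P_t$, $t\in\Theta_0$, its $\mu$-density is taken to be $p_t$. *The tests.*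 For $\epsilon\in(0,1)$, an alternative density $p_1$ and its RIPr $P_0$ with density $p_0$ and mass $k=\int p_0\,d\mu$, let $c',c''\in(0,\infty)$ solve $$(1-\epsilon)\{P_0[p_1/p_0<c'']+(c'')^{-1}P_1[p_1/p_0\ge c'']\}=k,\qquad (1-\epsilon)\{P_1[p_1/p_0>c']+c'P_0[p_1/p_0\le c']\}=1,$$ let $Q_{0,\epsilon}$ have density $q_{0,\epsilon}=(1-\epsilon)p_0$ where $p_1/p_0<c''$ and $(1-\epsilon)p_1/c''$ elsewhere, and let $Q_{1,\epsilon}$ have density $q_{1,\epsilon}=(1-\epsilon)p_1$ where $p_1/p_0>c'$ and $c'(1-\epsilon)p_0$ elsewhere. Write $\pi_\epsilon=\max\{c',\min\{c'',p_1/p_0\}\}$ (which equals $q_{1,\epsilon}/q_{0,\epsilon}$ when $c'<c''$; here $0/0$ is read as $0$ in $p_1/p_0$), $N_\epsilon=\sup_{P\in\mathcal P_0}\mathbb E_P[\pi_\epsilon]+(c''-c')\epsilon$ and $B_\epsilon=\pi_\epsilon/N_\epsilon$. Given observations $X_1,X_2,\dots$, put $R^{\mathrm{RIPr}}_{n,\epsilon}=\prod_{i=1}^nB_\epsilon(X_i)$,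 with $B_\epsilon$ built from $p_1=p_{\theta_1}$. Given estimators $\hat\theta_n=\hat\theta_n(X_1,\dots,X_{n-1})\in\Theta_1$, put $R^{\mathrm{RIPr,plug\text{-}in}}_{n,\epsilon}=\prod_{i=1}^n\hat B_{i,\epsilon}(X_i)$, where $\hat B_{i,\epsilon}$ is built in the same way from $p_{\hat\theta_i}$ if the corresponding constants satisfy $c_i'<c_i''$, and $\hat B_{i,\epsilon}=1$ otherwise. From here on, $P_0,c',c'',q_{j,\epsilon},Q_{j,\epsilon},\pi_\epsilon,N_\epsilon$ refer to the alternative $P_1=P_{\theta_1}$ and its RIPr $P_0$. For a probability measure $Q$ put $$r^{Q,\epsilon}_{\mathrm{RIPr}}=\mathbb E_Q\log\pi_\epsilon(X)-\log N_\epsilon .$$ **Claim.** $P_0$ is the RIPr of $P_1$, and: 1. Let $0<\epsilon<1$ be such that $c'<c''$, and let $Q$ be a probability measure in the $\epsilon$-neighbourhood of $P_1$, that is, $Q=(1-\epsilon)P_1+\epsilon H$ for some probability measure $H$, or $D_{\mathrm{TV}}(P_1,Q)\le\epsilon$. If $X_1,X_2,\dots$ are i.i.d. from $Q$ and $\hat\theta_n\to\theta_1$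 almost surely, then, as $n\to\infty$, almost surely $$\tfrac1n\log R^{\mathrm{RIPr,plug\text{-}in}}_{n,\epsilon}\to r^{Q,\epsilon}_{\mathrm{RIPr}},$$ and $r^{Q,\epsilon}_{\mathrm{RIPr}}$ is also the almost sure limit of $\frac1n\log R^{\mathrm{RIPr}}_{n,\epsilon}$. Moreover $D_{\mathrm{KL}}(Q_{1,\epsilon},Q_{0,\epsilon})<\infty$ and $$r^{Q,\epsilon}_{\mathrm{RIPr}}\ \ge\ D_{\mathrm{KL}}(Q_{1,\epsilon},Q_{0,\epsilon})-2(\log c''-\log c')\epsilon-\log\Big(\sup_{P\in\mathcal P_0}\mathbb E_P\big[\pi_\epsilon(X)\big]+(c''-c')\epsilon\Big).$$ 2. $D_{\mathrm{KL}}(P_1,P_0)<\infty$, and for every choice of $Q_\epsilon$ in the $\epsilon$-neighbourhood of $P_1$ ($0<\epsilon<1$), $r^{Q_\epsilon,\epsilon}_{\mathrm{RIPr}}\to D_{\mathrm{KL}}(P_1,P_0)$ as $\epsilon\downarrow 0$. -/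

import Mathlib

open MeasureTheory ProbabilityTheory Filter Topology
open scoped ENNReal

noncomputable section

namespace RobustRIPr

variable {𝒳 : Type*} [MeasurableSpace 𝒳]

/-! ### Neighbourhoods of a distribution -/

/-- The `ε`-contamination neighbourhood `{(1 - ε) P + ε H : H a probability measure}`. -/
def contaminationBall (ε : ℝ) (P : Measure 𝒳) : Set (Measure 𝒳) :=
  {Q | IsProbabilityMeasure Q ∧ ∃ H : Measure 𝒳, IsProbabilityMeasure H ∧
    Q = ENNReal.ofReal (1 - ε) • P + ENNReal.ofReal ε • H}

/-- Total variation distance `sup_S |P(S) - Q(S)|` over measurable sets `S`. -/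
def tvDist (P Q : Measure 𝒳) : ℝ :=
  ⨆ S : {S : Set 𝒳 // MeasurableSet S}, |P.real S.1 - Q.real S.1|

/-- The closed total variation ball of probability measures around `P`. -/
def tvBall (ε : ℝ) (P : Measure 𝒳) : Set (Measure 𝒳) :=
  {Q | IsProbabilityMeasure Q ∧ tvDist P Q ≤ ε}

/-! ### E-variables, the numeraire and the reverse information projection -/

/-- `B` is a `[0, ∞]`-valued e-variable for the set `𝒩` of measures. -/
def IsEVariable (𝒩 : Set (Measure 𝒳)) (B : 𝒳 → ℝ≥0∞) : Prop :=
  Measurable B ∧ ∀ P ∈ 𝒩, ∫⁻ x, B x ∂P ≤ 1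

/-- `B` is a numeraire for the null `𝒩` and the alternative `P₁`: a `P₁`-almost surely positive
e-variable with `E_{P₁}[B' / B] ≤ 1` for every e-variable `B'`. -/
def IsNumeraire (𝒩 : Set (Measure 𝒳)) (P₁ : Measure 𝒳) (B : 𝒳 → ℝ≥0∞) : Prop :=
  IsEVariable 𝒩 B ∧ (∀ᵐ x ∂P₁, 0 < B x) ∧
    ∀ B' : 𝒳 → ℝ≥0∞, IsEVariable 𝒩 B' → ∫⁻ x, B' x / B x ∂P₁ ≤ 1

/-- `P₀` is the reverse information projection of `P₁` on `𝒩`: `dP₀/dP₁ = 1/B` for the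
numeraire `B`. -/
def IsRIPr (𝒩 : Set (Measure 𝒳)) (P₁ P₀ : Measure 𝒳) : Prop :=
  ∃ B : 𝒳 → ℝ≥0∞, IsNumeraire 𝒩 P₁ B ∧ P₀ = P₁.withDensity (fun x => (B x)⁻¹)

/-! ### Truncated likelihood ratios

Below `p₀`, `p₁` are densities of `P₀`, `P₁` with respect to `μ`; `P₁` is a probability measure and
`P₀` may be a sub-probability measure. -/

/-- `c''`: the solution `c > 0` of
`(1 - ε) {P₀[p₁/p₀ < c] + c⁻¹ P₁[p₁/p₀ ≥ c]} = P₀(𝒳)`. -/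
def upperThreshold (μ : Measure 𝒳) (ε : ℝ) (p₀ p₁ : 𝒳 → ℝ≥0∞) : ℝ :=
  sInf {c : ℝ | 0 < c ∧
    (1 - ε) * ((μ.withDensity p₀).real {x | p₁ x / p₀ x < ENNReal.ofReal c}
        + c⁻¹ * (μ.withDensity p₁).real {x | ENNReal.ofReal c ≤ p₁ x / p₀ x})
      = (μ.withDensity p₀).real Set.univ}

/-- `c'`: the solution `c > 0` of
`(1 - ε) {P₁[p₁/p₀ > c] + c P₀[p₁/p₀ ≤ c]} = 1`. -/
def lowerThreshold (μ : Measure 𝒳) (ε : ℝ) (p₀ p₁ : 𝒳 → ℝ≥0∞) : ℝ :=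
  sInf {c : ℝ | 0 < c ∧
    (1 - ε) * ((μ.withDensity p₁).real {x | ENNReal.ofReal c < p₁ x / p₀ x}
        + c * (μ.withDensity p₀).real {x | p₁ x / p₀ x ≤ ENNReal.ofReal c})
      = 1}

/-- The density `q_{0,ε}`. -/
def q₀ (μ : Measure 𝒳) (ε : ℝ) (p₀ p₁ : 𝒳 → ℝ≥0∞) (x : 𝒳) : ℝ≥0∞ :=
  let c := ENNReal.ofReal (upperThreshold μ ε p₀ p₁)
  if p₁ x / p₀ x < c then ENNReal.ofReal (1 - ε) * p₀ x
  else c⁻¹ * (ENNReal.ofReal (1 - ε) * p₁ x)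

/-- The density `q_{1,ε}`. -/
def q₁ (μ : Measure 𝒳) (ε : ℝ) (p₀ p₁ : 𝒳 → ℝ≥0∞) (x : 𝒳) : ℝ≥0∞ :=
  let c := ENNReal.ofReal (lowerThreshold μ ε p₀ p₁)
  if c < p₁ x / p₀ x then ENNReal.ofReal (1 - ε) * p₁ x
  else c * (ENNReal.ofReal (1 - ε) * p₀ x)

/-- The measure `Q_{0,ε}`. -/
def Q₀ (μ : Measure 𝒳) (ε : ℝ) (p₀ p₁ : 𝒳 → ℝ≥0∞) : Measure 𝒳 :=
  μ.withDensity (q₀ μ ε p₀ p₁)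

/-- The measure `Q_{1,ε}`. -/
def Q₁ (μ : Measure 𝒳) (ε : ℝ) (p₀ p₁ : 𝒳 → ℝ≥0∞) : Measure 𝒳 :=
  μ.withDensity (q₁ μ ε p₀ p₁)

/-- The ratio `q_{1,ε}/q_{0,ε} = max {c', min {c'', p₁/p₀}}`, as an everywhere defined function.
(Where `p₀ x = p₁ x = 0`, the quotient `p₁ x / p₀ x` is `0`.) -/
def truncRatio (μ : Measure 𝒳) (ε : ℝ) (p₀ p₁ : 𝒳 → ℝ≥0∞) (x : 𝒳) : ℝ :=
  (max (ENNReal.ofReal (lowerThreshold μ ε p₀ p₁))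
    (min (ENNReal.ofReal (upperThreshold μ ε p₀ p₁)) (p₁ x / p₀ x))).toReal

/-- The truncated ratio is the quotient of the densities `q_{1,ε}` and `q_{0,ε}`. -/
theorem q₁_div_q₀ (μ : Measure 𝒳) (ε : ℝ) (p₀ p₁ : 𝒳 → ℝ≥0∞) (x : 𝒳) (hε : ε < 1)
    (hl : 0 < lowerThreshold μ ε p₀ p₁)
    (hlu : lowerThreshold μ ε p₀ p₁ < upperThreshold μ ε p₀ p₁)
    (h0 : p₀ x ≠ 0) (h0' : p₀ x ≠ ∞) (h1' : p₁ x ≠ ∞) :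
    q₁ μ ε p₀ p₁ x / q₀ μ ε p₀ p₁ x = ENNReal.ofReal (truncRatio μ ε p₀ p₁ x) := by
  have hu : 0 < upperThreshold μ ε p₀ p₁ := hl.trans hlu
  have he : ENNReal.ofReal (1 - ε) ≠ 0 := by
    simpa using hε
  have he' : ENNReal.ofReal (1 - ε) ≠ ∞ := ENNReal.ofReal_ne_top
  have hlu' : ENNReal.ofReal (lowerThreshold μ ε p₀ p₁)
      < ENNReal.ofReal (upperThreshold μ ε p₀ p₁) := (ENNReal.ofReal_lt_ofReal_iff hu).2 hlu
  have hl0 : ENNReal.ofReal (lowerThreshold μ ε p₀ p₁) ≠ 0 := by simpa using hl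
  have hu0 : ENNReal.ofReal (upperThreshold μ ε p₀ p₁) ≠ 0 := by simpa using hu
  have hlt : ENNReal.ofReal (lowerThreshold μ ε p₀ p₁) ≠ ∞ := ENNReal.ofReal_ne_top
  have hut : ENNReal.ofReal (upperThreshold μ ε p₀ p₁) ≠ ∞ := ENNReal.ofReal_ne_top
  unfold q₁ q₀ truncRatio
  rw [ENNReal.ofReal_toReal (by simp [hlt, hut])]
  set c := ENNReal.ofReal (lowerThreshold μ ε p₀ p₁)
  set d := ENNReal.ofReal (upperThreshold μ ε p₀ p₁)
  set e := ENNReal.ofReal (1 - ε)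
  simp only
  by_cases hc : c < p₁ x / p₀ x
  · by_cases hd : p₁ x / p₀ x < d
    · rw [if_pos hc, if_pos hd, min_eq_right hd.le, max_eq_right hc.le,
        ENNReal.mul_div_mul_left _ _ he he']
    · have hp1 : p₁ x ≠ 0 := by
        intro h; simp [h] at hc
      rw [if_pos hc, if_neg hd, min_eq_left (not_lt.1 hd), max_eq_right hlu'.le, div_eq_mul_inv,
        ENNReal.mul_inv (Or.inl (ENNReal.inv_ne_zero.2 hut)) (Or.inl (ENNReal.inv_ne_top.2 hu0)),
        inv_inv, mul_left_comm, ENNReal.mul_inv_cancel (mul_ne_zero he hp1)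
          (ENNReal.mul_ne_top he' h1'), mul_one]
  · have hd : p₁ x / p₀ x < d := (not_lt.1 hc).trans_lt hlu'
    rw [if_neg hc, if_pos hd, min_eq_right hd.le, max_eq_left (not_lt.1 hc), mul_div_assoc,
      ENNReal.div_self (mul_ne_zero he h0) (ENNReal.mul_ne_top he' h0'), mul_one]

/-- The normalising constant `sup_{P ∈ 𝒩} E_P[q_{1,ε}/q_{0,ε}] + (c'' - c') ε`. -/
def normalizer (μ : Measure 𝒳) (𝒩 : Set (Measure 𝒳)) (ε : ℝ) (p₀ p₁ : 𝒳 → ℝ≥0∞) : ℝ :=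
  (⨆ P : 𝒩, ∫ x, truncRatio μ ε p₀ p₁ x ∂(P : Measure 𝒳))
    + (upperThreshold μ ε p₀ p₁ - lowerThreshold μ ε p₀ p₁) * ε

/-- The robustified numeraire `B_ε`. -/
def bet (μ : Measure 𝒳) (𝒩 : Set (Measure 𝒳)) (ε : ℝ) (p₀ p₁ : 𝒳 → ℝ≥0∞) (x : 𝒳) : ℝ :=
  truncRatio μ ε p₀ p₁ x / normalizer μ 𝒩 ε p₀ p₁

open Classical in
/-- The factor used by the plug-in test: `B_ε` if `c' < c''`, and `1` otherwise. -/
def plugInBet (μ : Measure 𝒳) (𝒩 : Set (Measure 𝒳)) (ε : ℝ) (p₀ p₁ : 𝒳 → ℝ≥0∞) (x : 𝒳) : ℝ :=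
  if lowerThreshold μ ε p₀ p₁ < upperThreshold μ ε p₀ p₁ then bet μ 𝒩 ε p₀ p₁ x else 1

/-- The constant `r^{Q,ε} = E_Q log (q_{1,ε}/q_{0,ε})
  - log (sup_{P ∈ 𝒩} E_P[q_{1,ε}/q_{0,ε}] + (c'' - c') ε)`. -/
def growthRate (μ : Measure 𝒳) (𝒩 : Set (Measure 𝒳)) (ε : ℝ) (p₀ p₁ : 𝒳 → ℝ≥0∞)
    (Q : Measure 𝒳) : ℝ :=
  ∫ x, Real.log (truncRatio μ ε p₀ p₁ x) ∂Q - Real.log (normalizer μ 𝒩 ε p₀ p₁)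

/-! ### One-parameter exponential families -/

/-- A one-parameter exponential family `p_θ(x) = h(x) exp(θ T(x) - A(θ))`, `θ ∈ ℝ`, of probability
densities with respect to `μ`. -/
structure ExpFamily (𝒳 : Type*) [MeasurableSpace 𝒳] where
  μ : Measure 𝒳
  h : 𝒳 → ℝ
  T : 𝒳 → ℝ
  A : ℝ → ℝ
  measurable_h : Measurable h
  measurable_T : Measurable T
  h_nonneg : ∀ x, 0 ≤ h x
  lintegral_density : ∀ θ : ℝ, ∫⁻ x, ENNReal.ofReal (h x * Real.exp (θ * T x - A θ)) ∂μ = 1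

namespace ExpFamily

variable (F : ExpFamily 𝒳)

/-- The density `p_θ`. -/
def p (θ : ℝ) (x : 𝒳) : ℝ≥0∞ :=
  ENNReal.ofReal (F.h x * Real.exp (θ * F.T x - F.A θ))

/-- The distribution `P_θ`. -/
def P (θ : ℝ) : Measure 𝒳 := F.μ.withDensity (F.p θ)

/-- The set of distributions `{P_θ : θ ∈ Θ}`. -/
def family (Θ : Set ℝ) : Set (Measure 𝒳) := F.P '' Θ

open Classical in
/-- The density of the reverse information projection of `P_θ` on `{P_t : t ∈ Θ₀}`. If the
projection is a member `P_t` of the null, its density is `p_t`; otherwise it is `p_θ / B` for a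
numeraire `B`. (A numeraire always exists, so the last branch is never used.) -/
def riprDensity (Θ₀ : Set ℝ) (θ : ℝ) : 𝒳 → ℝ≥0∞ :=
  if H : ∃ t ∈ Θ₀, IsRIPr (F.family Θ₀) (F.P θ) (F.P t) then F.p H.choose
  else if H' : ∃ B, IsNumeraire (F.family Θ₀) (F.P θ) B then fun x => F.p θ x / H'.choose x
  else F.p θ

/-- The reverse information projection of `P_θ` on `{P_t : t ∈ Θ₀}`. -/
def ripr (Θ₀ : Set ℝ) (θ : ℝ) : Measure 𝒳 := F.μ.withDensity (F.riprDensity Θ₀ θ)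

/-- The process `R_{n,ε}^{RIPr}` for the alternative `P_θ`, along observations
`x 0, x 1, x 2, …`. -/
def riprWealth (Θ₀ : Set ℝ) (ε θ : ℝ) (x : ℕ → 𝒳) (n : ℕ) : ℝ :=
  ∏ i ∈ Finset.range n, bet F.μ (F.family Θ₀) ε (F.riprDensity Θ₀ θ) (F.p θ) (x i)

/-- The process `R_{n,ε}^{RIPr,plug-in}`, along observations `x 0, x 1, x 2, …`. The estimate used
for betting on `x i` is `θhat i` evaluated at the previous observations `x 0, …, x (i - 1)`. -/
def plugInWealth (Θ₀ : Set ℝ) (ε : ℝ) (θhat : (i : ℕ) → (Fin i → 𝒳) → ℝ) (x : ℕ → 𝒳) (n : ℕ) :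
    ℝ :=
  ∏ i ∈ Finset.range n,
    plugInBet F.μ (F.family Θ₀) ε (F.riprDensity Θ₀ (θhat i fun j => x j))
      (F.p (θhat i fun j => x j)) (x i)

/-- The constant `c'` for the alternative `P_θ` and its projection. -/
def cLower (Θ₀ : Set ℝ) (ε θ : ℝ) : ℝ := lowerThreshold F.μ ε (F.riprDensity Θ₀ θ) (F.p θ)

/-- The constant `c''` for the alternative `P_θ` and its projection. -/
def cUpper (Θ₀ : Set ℝ) (ε θ : ℝ) : ℝ := upperThreshold F.μ ε (F.riprDensity Θ₀ θ) (F.p θ)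

/-- The measure `Q_{0,ε}` for the alternative `P_θ` and its projection. -/
def Q₀ (Θ₀ : Set ℝ) (ε θ : ℝ) : Measure 𝒳 :=
  RobustRIPr.Q₀ F.μ ε (F.riprDensity Θ₀ θ) (F.p θ)

/-- The measure `Q_{1,ε}` for the alternative `P_θ` and its projection. -/
def Q₁ (Θ₀ : Set ℝ) (ε θ : ℝ) : Measure 𝒳 :=
  RobustRIPr.Q₁ F.μ ε (F.riprDensity Θ₀ θ) (F.p θ)

/-- The normalising constant for the alternative `P_θ` and its projection. -/
def normConst (Θ₀ : Set ℝ) (ε θ : ℝ) : ℝ :=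
  normalizer F.μ (F.family Θ₀) ε (F.riprDensity Θ₀ θ) (F.p θ)

/-- The growth rate under `Q` of the test for the alternative `P_θ` and its projection. -/
def rate (Θ₀ : Set ℝ) (ε θ : ℝ) (Q : Measure 𝒳) : ℝ :=
  growthRate F.μ (F.family Θ₀) ε (F.riprDensity Θ₀ θ) (F.p θ) Q

end ExpFamily

end RobustRIPr

end

/-! Both thresholds are roots of the same kind of equation. Since `p₁/p₀ > c` means `p₁ > c p₀`, the
defining equations say `∫ max (p₁, c' p₀) = 1/(1-ε)` and, for a projection of mass one, `∫ max (p₀,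
p₁/c'') = 1/(1-ε)`. On `c ≥ 0` the map `c ↦ ∫ max (f, c g)` is convex, Lipschitz, and strictly
increasing once it exceeds `∫ f`; this gives existence, uniqueness and continuous dependence of the
roots (`exists_unique_maxMass_eq`, `tendsto_of_maxMass_eq`).

Let `s` be the extremal null parameter facing `θ`. The `P_t`-expectation of `p_θ/p_s` is `exp
(A(t+θ-s) + A(s) - A(t) - A(θ))`. It is at most `1` by convexity of `A`, because `s` and `t+θ-s` lie
between `θ` and `t` and have the same sum. A change of measure then makes `p_θ/p_s` the numeraire,
so the projection is `P_s` (`isNumeraire_expRatio`). Monotonicity of the likelihood ratio places the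
supremum in the normaliser at `P_s` (`normalizer_eq`).

For the plug-in test, log-likelihood ratios are affine in `T`, so after truncation the log bets at
`θ` and `θ₁` are close uniformly in `x` as `θ → θ₁` (`eventually_abs_log_plugInBet_sub_le`). The
strong law handles the fixed bet and Cesàro averaging the difference. The lower bound holds because
`D_KL(Q₁, Q₀)` is the `Q₁`-mean of `log π`, and `Q` and `Q₁` are both within `ε` of `P₁` in total
variation.

As `ε ↓ 0`, the bounds `ε ≤ c'` and `c'' ≤ 1/ε` make the cost of replacing `Q_ε` by `P₁` of order `ε
|log ε|`. A finite second moment of the likelihood ratio gives `c'' ε → 0`, hence the normaliser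
tends to `1` (`tendsto_normalizer`), and dominated convergence removes the truncation
(`tendsto_integral_log_truncRatio`). -/

noncomputable section

namespace RobustRIPr

variable {𝒳 : Type*} [MeasurableSpace 𝒳]

/-! ### The mass of the maximum of two densities -/

/-- The integral of `max (f, c g)`. -/
def maxMass (μ : Measure 𝒳) (f g : 𝒳 → ℝ) (c : ℝ) : ℝ := ∫ x, max (f x) (c * g x) ∂μ

section maxMass

variable {μ : Measure 𝒳} {f g : 𝒳 → ℝ}

theorem integrable_max_mul (hf : Integrable f μ) (hg : Integrable g μ) (c : ℝ) :
    Integrable (fun x => max (f x) (c * g x)) μ :=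
  hf.sup (hg.const_mul c)

theorem maxMass_mono (hf : Integrable f μ) (hg : Integrable g μ) (hg0 : ∀ x, 0 ≤ g x) :
    Monotone (maxMass μ f g) := fun _ _ hab =>
  integral_mono (integrable_max_mul hf hg _) (integrable_max_mul hf hg _) fun x =>
    max_le_max le_rfl (mul_le_mul_of_nonneg_right hab (hg0 x))

theorem le_maxMass (hf : Integrable f μ) (hg : Integrable g μ) (c : ℝ) :
    ∫ x, f x ∂μ ≤ maxMass μ f g c :=
  integral_mono hf (integrable_max_mul hf hg _) fun _ => le_max_left _ _

theorem mul_le_maxMass (hf : Integrable f μ) (hg : Integrable g μ) (c : ℝ) :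
    c * ∫ x, g x ∂μ ≤ maxMass μ f g c := by
  rw [← integral_const_mul]
  exact integral_mono (hg.const_mul c) (integrable_max_mul hf hg _) fun _ => le_max_right _ _

theorem maxMass_le (hf : Integrable f μ) (hg : Integrable g μ) (hf0 : ∀ x, 0 ≤ f x)
    (hg0 : ∀ x, 0 ≤ g x) {c : ℝ} (hc : 0 ≤ c) :
    maxMass μ f g c ≤ ∫ x, f x ∂μ + c * ∫ x, g x ∂μ := by
  rw [← integral_const_mul, ← integral_add hf (hg.const_mul c)]
  refine integral_mono (integrable_max_mul hf hg _) (hf.add (hg.const_mul c)) fun x => ?_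
  exact max_le_add_of_nonneg (hf0 x) (mul_nonneg hc (hg0 x))

theorem continuous_maxMass (hf : Integrable f μ) (hg : Integrable g μ) (hg0 : ∀ x, 0 ≤ g x) :
    Continuous (maxMass μ f g) := by
  have key : ∀ a b, maxMass μ f g a ≤ maxMass μ f g b + |a - b| * ∫ x, g x ∂μ := by
    intro a b
    rw [← integral_const_mul, maxMass, maxMass,
      ← integral_add (integrable_max_mul hf hg b) (hg.const_mul _)]
    refine integral_mono (integrable_max_mul hf hg a)
      ((integrable_max_mul hf hg b).add (hg.const_mul _)) fun x => ?_
    have h1 : (a - b) * g x ≤ |a - b| * g x :=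
      mul_le_mul_of_nonneg_right (le_abs_self _) (hg0 x)
    have h2 : 0 ≤ |a - b| * g x := mul_nonneg (abs_nonneg _) (hg0 x)
    refine max_le ?_ ?_
    · linarith [le_max_left (f x) (b * g x)]
    · linarith [le_max_right (f x) (b * g x)]
  have hk : 0 ≤ ∫ x, g x ∂μ := integral_nonneg hg0
  refine (LipschitzWith.of_dist_le_mul (K := (∫ x, g x ∂μ).toNNReal) fun a b => ?_).continuous
  rw [Real.dist_eq, Real.dist_eq, Real.coe_toNNReal _ hk, abs_le]
  constructor
  · have := key b a
    rw [abs_sub_comm] at this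
    linarith
  · linarith [key a b]

/-- Convexity in `c`: writing `a` as a convex combination of `0` and `b`, the value at `a` is at
most the same combination of `∫ f` and the value at `b`, with positive weight on the strictly
smaller `∫ f`. -/
theorem maxMass_lt_maxMass (hf : Integrable f μ) (hg : Integrable g μ) (hf0 : ∀ x, 0 ≤ f x)
    {a b : ℝ} (ha : 0 ≤ a) (hab : a < b)
    (hb : ∫ x, f x ∂μ < maxMass μ f g b) : maxMass μ f g a < maxMass μ f g b := by
  have hb0 : 0 < b := ha.trans_lt hab
  have hl1 : a / b < 1 := (div_lt_one hb0).2 hab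
  have hl0 : 0 ≤ a / b := div_nonneg ha hb0.le
  have key : maxMass μ f g a ≤ (1 - a / b) * ∫ x, f x ∂μ + a / b * maxMass μ f g b := by
    rw [maxMass, maxMass, ← integral_const_mul, ← integral_const_mul,
      ← integral_add (hf.const_mul _) ((integrable_max_mul hf hg b).const_mul _)]
    refine integral_mono (integrable_max_mul hf hg a)
      ((hf.const_mul _).add ((integrable_max_mul hf hg b).const_mul _)) fun x => ?_
    have e : a * g x = a / b * (b * g x) := by field_simp
    have h1 := mul_le_mul_of_nonneg_left (le_max_left (f x) (b * g x)) hl0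
    have h2 := mul_le_mul_of_nonneg_left (le_max_right (f x) (b * g x)) hl0
    have h3 : 0 ≤ (1 - a / b) * f x := mul_nonneg (by linarith) (hf0 x)
    refine max_le ?_ ?_
    · linarith
    · rw [e]
      linarith
  nlinarith

/-- Intermediate value theorem on `[0, v / ∫ g]`: the value at `0` is `∫ f < v`, and `c ∫ g ≤
maxMass μ f g c` forces `v` to be reached by the right end. Uniqueness is strict monotonicity above
`∫ f`. -/
theorem exists_unique_maxMass_eq (hf : Integrable f μ) (hg : Integrable g μ) (hf0 : ∀ x, 0 ≤ f x)
    (hg0 : ∀ x, 0 ≤ g x) (hgpos : 0 < ∫ x, g x ∂μ) {v : ℝ} (hv : ∫ x, f x ∂μ < v) :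
    ∃ c, 0 < c ∧ maxMass μ f g c = v ∧ ∀ c', 0 < c' → maxMass μ f g c' = v → c' = c := by
  have hv0 : 0 < v := (integral_nonneg hf0).trans_lt hv
  have h0 : maxMass μ f g 0 = ∫ x, f x ∂μ := by
    simp only [maxMass, zero_mul]
    exact integral_congr_ae (ae_of_all _ fun x => max_eq_left (hf0 x))
  have hK : v ≤ maxMass μ f g (v / ∫ x, g x ∂μ) := by
    refine le_trans (le_of_eq ?_) (mul_le_maxMass hf hg _)
    field_simp
  obtain ⟨c, hc, hcv⟩ := intermediate_value_Icc (div_nonneg hv0.le hgpos.le)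
    (continuous_maxMass hf hg hg0).continuousOn ⟨h0.trans_le hv.le, hK⟩
  have hc0 : 0 < c := by
    rcases hc.1.eq_or_lt with h | h
    · rw [← h, h0] at hcv
      exact absurd hcv hv.ne
    · exact h
  refine ⟨c, hc0, hcv, fun c' hc' hcv' => ?_⟩
  rcases lt_trichotomy c' c with h | h | h
  · have := maxMass_lt_maxMass hf hg hf0 hc'.le h (hv.trans_eq hcv.symm)
    linarith
  · exact h
  · have := maxMass_lt_maxMass hf hg hf0 hc0.le h (hv.trans_eq hcv'.symm)
    linarith

theorem lt_of_maxMass_lt (hf : Integrable f μ) (hg : Integrable g μ) (hg0 : ∀ x, 0 ≤ g x)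
    {a b : ℝ} (h : maxMass μ f g a < maxMass μ f g b) : a < b :=
  (maxMass_mono hf hg hg0).reflect_lt h

/-- Solutions of `∫ max (f, c g) = v` depend continuously on `f` and `g`. -/
theorem tendsto_of_maxMass_eq {ι : Type*} {l : Filter ι} {fs gs : ι → 𝒳 → ℝ} {cs : ι → ℝ} {c v : ℝ}
    (hf : Integrable f μ) (hg : Integrable g μ) (hf0 : ∀ x, 0 ≤ f x) (hc : 0 < c)
    (hcv : maxMass μ f g c = v) (hv : ∫ x, f x ∂μ < v)
    (hfs : ∀ i, Integrable (fs i) μ) (hgs : ∀ i, Integrable (gs i) μ) (hgs0 : ∀ i x, 0 ≤ gs i x)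
    (hcs : ∀ᶠ i in l, 0 < cs i ∧ maxMass μ (fs i) (gs i) (cs i) = v)
    (hg0 : ∀ x, 0 ≤ g x)
    (hlim : ∀ b, Tendsto (fun i => maxMass μ (fs i) (gs i) b) l (𝓝 (maxMass μ f g b))) :
    Tendsto cs l (𝓝 c) := by
  -- For `a < c < b` the limiting values at `a` and `b` lie strictly on either side of `v`.
  -- Pointwise convergence preserves this, and monotonicity traps the roots between `a` and `b`.
  refine tendsto_order.2 ⟨fun a ha => ?_, fun b hb => ?_⟩
  · rcases le_or_gt 0 a with ha0 | ha0
    · have h1 : maxMass μ f g a < v :=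
        hcv ▸ maxMass_lt_maxMass hf hg hf0 ha0 ha (hv.trans_eq hcv.symm)
      filter_upwards [hcs, (hlim a).eventually_lt_const h1] with i hi hi'
      exact lt_of_maxMass_lt (hfs i) (hgs i) (hgs0 i) (hi'.trans_eq hi.2.symm)
    · filter_upwards [hcs] with i hi
      exact ha0.trans hi.1
  · have h1 : v < maxMass μ f g b := hcv ▸ maxMass_lt_maxMass hf hg hf0 hc.le hb
      ((hv.trans_eq hcv.symm).trans_le (maxMass_mono hf hg hg0 hb.le))
    filter_upwards [hcs, (hlim b).eventually_const_lt h1] with i hi hi'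
    exact lt_of_maxMass_lt (hfs i) (hgs i) (hgs0 i) (hi.2.trans_lt hi')

end maxMass

/-! ### The thresholds as solutions of equations for `maxMass` -/

section thresholds

variable {μ : Measure 𝒳} {p₀ p₁ : 𝒳 → ℝ≥0∞}

theorem withDensity_real_eq_setIntegral {p : 𝒳 → ℝ≥0∞} (hp : Measurable p)
    (hpi : ∫⁻ x, p x ∂μ ≠ ∞) {S : Set 𝒳} (hS : MeasurableSet S) :
    (μ.withDensity p).real S = ∫ x in S, (p x).toReal ∂μ := by
  rw [integral_toReal hp.aemeasurable.restrict
    (ae_restrict_of_ae (ae_lt_top hp hpi)), Measure.real, withDensity_apply _ hS]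

/-- Ties `c g = f` may fall on either side of the split, so the strict and non-strict inequalities
in the two threshold equations lead to the same kind of integral. -/
theorem setIntegral_add_mul_setIntegral_compl {f g : 𝒳 → ℝ} (hf : Integrable f μ)
    (hg : Integrable g μ) (c : ℝ) {S : Set 𝒳} (hS : MeasurableSet S)
    (h1 : ∀ᵐ x ∂μ, x ∈ S → c * g x ≤ f x) (h2 : ∀ᵐ x ∂μ, x ∈ Sᶜ → f x ≤ c * g x) :
    ∫ x in S, f x ∂μ + c * ∫ x in Sᶜ, g x ∂μ = maxMass μ f g c := by
  rw [maxMass, ← integral_add_compl hS (integrable_max_mul hf hg c), ← integral_const_mul]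
  congr 1
  · refine setIntegral_congr_ae hS ?_
    filter_upwards [h1] with x hx hxS using (max_eq_left (hx hxS)).symm
  · refine setIntegral_congr_ae hS.compl ?_
    filter_upwards [h2] with x hx hxS using (max_eq_right (hx hxS)).symm

theorem mul_toReal_le_of_le_div {a b : ℝ≥0∞} {c : ℝ} (hc : 0 < c) (ha : a ≠ ∞)
    (h : ENNReal.ofReal c ≤ b / a) (hb : b ≠ ∞) : c * a.toReal ≤ b.toReal := by
  rcases eq_or_ne a 0 with rfl | ha0
  · simp
  · rw [ENNReal.le_div_iff_mul_le (Or.inl ha0) (Or.inl ha)] at h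
    have := ENNReal.toReal_mono hb h
    rwa [ENNReal.toReal_mul, ENNReal.toReal_ofReal hc.le] at this

theorem toReal_le_mul_of_div_le {a b : ℝ≥0∞} {c : ℝ} (hc : 0 < c) (ha : a ≠ ∞)
    (h : b / a ≤ ENNReal.ofReal c) : b.toReal ≤ c * a.toReal := by
  have h' : b ≤ ENNReal.ofReal c * a := by
    rcases eq_or_ne a 0 with rfl | ha0
    · rcases eq_or_ne b 0 with rfl | hb0
      · simp
      · rw [ENNReal.div_zero hb0] at h
        exact absurd h (by simp)
    · rwa [ENNReal.div_le_iff ha0 ha] at h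
  have := ENNReal.toReal_mono (ENNReal.mul_ne_top ENNReal.ofReal_ne_top ha) h'
  rwa [ENNReal.toReal_mul, ENNReal.toReal_ofReal hc.le] at this

theorem lower_mass_eq (h0 : Measurable p₀) (h1 : Measurable p₁) (hi0 : ∫⁻ x, p₀ x ∂μ ≠ ∞)
    (hi1 : ∫⁻ x, p₁ x ∂μ ≠ ∞) {c : ℝ} (hc : 0 < c) :
    (μ.withDensity p₁).real {x | ENNReal.ofReal c < p₁ x / p₀ x}
        + c * (μ.withDensity p₀).real {x | p₁ x / p₀ x ≤ ENNReal.ofReal c}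
      = maxMass μ (fun x => (p₁ x).toReal) (fun x => (p₀ x).toReal) c := by
  have hS : MeasurableSet {x | ENNReal.ofReal c < p₁ x / p₀ x} :=
    measurableSet_lt measurable_const (h1.div h0)
  have hSc : {x | p₁ x / p₀ x ≤ ENNReal.ofReal c} = {x | ENNReal.ofReal c < p₁ x / p₀ x}ᶜ := by
    ext x
    simp
  rw [hSc, withDensity_real_eq_setIntegral h1 hi1 hS,
    withDensity_real_eq_setIntegral h0 hi0 hS.compl]
  refine setIntegral_add_mul_setIntegral_compl (integrable_toReal_of_lintegral_ne_top
    h1.aemeasurable hi1) (integrable_toReal_of_lintegral_ne_top h0.aemeasurable hi0) c hS ?_ ?_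
  · filter_upwards [ae_lt_top h0 hi0, ae_lt_top h1 hi1] with x hx hx' hxS
    exact mul_toReal_le_of_le_div hc hx.ne (le_of_lt hxS) hx'.ne
  · filter_upwards [ae_lt_top h0 hi0] with x hx hxS
    exact toReal_le_mul_of_div_le hc hx.ne (not_lt.1 hxS)

theorem upper_mass_eq (h0 : Measurable p₀) (h1 : Measurable p₁) (hi0 : ∫⁻ x, p₀ x ∂μ ≠ ∞)
    (hi1 : ∫⁻ x, p₁ x ∂μ ≠ ∞) {c : ℝ} (hc : 0 < c) :
    (μ.withDensity p₀).real {x | p₁ x / p₀ x < ENNReal.ofReal c}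
        + c⁻¹ * (μ.withDensity p₁).real {x | ENNReal.ofReal c ≤ p₁ x / p₀ x}
      = maxMass μ (fun x => (p₀ x).toReal) (fun x => (p₁ x).toReal) c⁻¹ := by
  have hS : MeasurableSet {x | p₁ x / p₀ x < ENNReal.ofReal c} :=
    measurableSet_lt (h1.div h0) measurable_const
  have hSc : {x | ENNReal.ofReal c ≤ p₁ x / p₀ x} = {x | p₁ x / p₀ x < ENNReal.ofReal c}ᶜ := by
    ext x
    simp
  rw [hSc, withDensity_real_eq_setIntegral h0 hi0 hS,
    withDensity_real_eq_setIntegral h1 hi1 hS.compl]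
  refine setIntegral_add_mul_setIntegral_compl (integrable_toReal_of_lintegral_ne_top
    h0.aemeasurable hi0) (integrable_toReal_of_lintegral_ne_top h1.aemeasurable hi1) c⁻¹ hS ?_ ?_
  · filter_upwards [ae_lt_top h0 hi0] with x hx hxS
    rw [inv_mul_le_iff₀ hc]
    exact toReal_le_mul_of_div_le hc hx.ne (le_of_lt hxS)
  · filter_upwards [ae_lt_top h0 hi0, ae_lt_top h1 hi1] with x hx hx' hxS
    rw [le_inv_mul_iff₀ hc]
    exact mul_toReal_le_of_le_div hc hx.ne (not_lt.1 hxS) hx'.ne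

/-- The set whose infimum defines the threshold is a singleton, so the infimum is the solution
itself. -/
theorem lowerThreshold_spec (h0 : Measurable p₀) (h1 : Measurable p₁) (hi0 : ∫⁻ x, p₀ x ∂μ ≠ ∞)
    (hk : ∫⁻ x, p₀ x ∂μ ≠ 0) (hi1 : ∫⁻ x, p₁ x ∂μ = 1) {ε : ℝ} (hε : 0 < ε) (hε1 : ε < 1) :
    0 < lowerThreshold μ ε p₀ p₁ ∧
      maxMass μ (fun x => (p₁ x).toReal) (fun x => (p₀ x).toReal) (lowerThreshold μ ε p₀ p₁)
        = (1 - ε)⁻¹ := by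
  have hi1' : ∫⁻ x, p₁ x ∂μ ≠ ∞ := by simp [hi1]
  have he : 0 < 1 - ε := by linarith
  have hint : ∫ x, (p₁ x).toReal ∂μ = 1 := by
    rw [integral_toReal h1.aemeasurable (ae_lt_top h1 hi1'), hi1, ENNReal.toReal_one]
  have hpos : 0 < ∫ x, (p₀ x).toReal ∂μ := by
    rw [integral_toReal h0.aemeasurable (ae_lt_top h0 hi0)]
    exact ENNReal.toReal_pos hk hi0
  obtain ⟨c, hc, hcv, huniq⟩ := exists_unique_maxMass_eq
    (integrable_toReal_of_lintegral_ne_top h1.aemeasurable hi1')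
    (integrable_toReal_of_lintegral_ne_top h0.aemeasurable hi0) (fun _ => ENNReal.toReal_nonneg)
    (fun _ => ENNReal.toReal_nonneg) hpos (v := (1 - ε)⁻¹)
    (by rw [hint]; exact (one_lt_inv₀ he).2 (by linarith))
  have hset : {c : ℝ | 0 < c ∧
      (1 - ε) * ((μ.withDensity p₁).real {x | ENNReal.ofReal c < p₁ x / p₀ x}
        + c * (μ.withDensity p₀).real {x | p₁ x / p₀ x ≤ ENNReal.ofReal c}) = 1} = {c} := by
    ext d
    simp only [Set.mem_ofPred_eq, Set.mem_singleton_iff]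
    refine ⟨fun ⟨hd, hd'⟩ => huniq d hd ?_, ?_⟩
    · rw [lower_mass_eq h0 h1 hi0 hi1' hd] at hd'
      exact eq_inv_of_mul_eq_one_right hd'
    · rintro rfl
      refine ⟨hc, ?_⟩
      rw [lower_mass_eq h0 h1 hi0 hi1' hc, hcv, mul_inv_cancel₀ he.ne']
  have : lowerThreshold μ ε p₀ p₁ = c := by
    rw [lowerThreshold, hset, csInf_singleton]
  rw [this]
  exact ⟨hc, hcv⟩

/-- The unknown is `c⁻¹`, with the roles of the two densities exchanged. Mass one of `p₀` makes the
right-hand side the same as for the lower threshold. -/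
theorem upperThreshold_spec (h0 : Measurable p₀) (h1 : Measurable p₁) (hi0 : ∫⁻ x, p₀ x ∂μ = 1)
    (hi1 : ∫⁻ x, p₁ x ∂μ = 1) {ε : ℝ} (hε : 0 < ε) (hε1 : ε < 1) :
    0 < upperThreshold μ ε p₀ p₁ ∧
      maxMass μ (fun x => (p₀ x).toReal) (fun x => (p₁ x).toReal) (upperThreshold μ ε p₀ p₁)⁻¹
        = (1 - ε)⁻¹ := by
  have hi1' : ∫⁻ x, p₁ x ∂μ ≠ ∞ := by simp [hi1]
  have hi0' : ∫⁻ x, p₀ x ∂μ ≠ ∞ := by simp [hi0]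
  have he : 0 < 1 - ε := by linarith
  have hint0 : ∫ x, (p₀ x).toReal ∂μ = 1 := by
    rw [integral_toReal h0.aemeasurable (ae_lt_top h0 hi0'), hi0, ENNReal.toReal_one]
  have hint1 : ∫ x, (p₁ x).toReal ∂μ = 1 := by
    rw [integral_toReal h1.aemeasurable (ae_lt_top h1 hi1'), hi1, ENNReal.toReal_one]
  obtain ⟨s, hs, hsv, huniq⟩ := exists_unique_maxMass_eq
    (integrable_toReal_of_lintegral_ne_top h0.aemeasurable hi0')
    (integrable_toReal_of_lintegral_ne_top h1.aemeasurable hi1') (fun _ => ENNReal.toReal_nonneg)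
    (fun _ => ENNReal.toReal_nonneg) (by rw [hint1]; exact one_pos) (v := (1 - ε)⁻¹)
    (by rw [hint0]; exact (one_lt_inv₀ he).2 (by linarith))
  have huniv : (μ.withDensity p₀).real Set.univ = 1 := by
    rw [Measure.real, withDensity_apply _ MeasurableSet.univ, setLIntegral_univ, hi0,
      ENNReal.toReal_one]
  have hset : {c : ℝ | 0 < c ∧
      (1 - ε) * ((μ.withDensity p₀).real {x | p₁ x / p₀ x < ENNReal.ofReal c}
        + c⁻¹ * (μ.withDensity p₁).real {x | ENNReal.ofReal c ≤ p₁ x / p₀ x})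
      = (μ.withDensity p₀).real Set.univ} = {s⁻¹} := by
    ext d
    simp only [Set.mem_ofPred_eq, Set.mem_singleton_iff, huniv]
    refine ⟨fun ⟨hd, hd'⟩ => ?_, ?_⟩
    · rw [upper_mass_eq h0 h1 hi0' hi1' hd] at hd'
      rw [← huniq d⁻¹ (inv_pos.2 hd) (eq_inv_of_mul_eq_one_right hd'), inv_inv]
    · rintro rfl
      refine ⟨inv_pos.2 hs, ?_⟩
      rw [upper_mass_eq h0 h1 hi0' hi1' (inv_pos.2 hs), inv_inv, hsv, mul_inv_cancel₀ he.ne']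
  have : upperThreshold μ ε p₀ p₁ = s⁻¹ := by
    rw [upperThreshold, hset, csInf_singleton]
  rw [this, inv_inv]
  exact ⟨inv_pos.2 hs, hsv⟩

theorem truncRatio_pos {ε : ℝ} (hl : 0 < lowerThreshold μ ε p₀ p₁) (x : 𝒳) :
    0 < truncRatio μ ε p₀ p₁ x := by
  refine ENNReal.toReal_pos (ne_of_gt (lt_max_of_lt_left ?_)) ?_
  · simpa using hl
  · simp

theorem normalizer_pos {𝒩 : Set (Measure 𝒳)} {ε : ℝ} (hε : 0 < ε)
    (hlu : lowerThreshold μ ε p₀ p₁ < upperThreshold μ ε p₀ p₁) :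
    0 < normalizer μ 𝒩 ε p₀ p₁ := by
  -- No boundedness is needed: a real supremum over an unbounded family defaults to `0`, which is
  -- still nonnegative.
  refine add_pos_of_nonneg_of_pos (Real.iSup_nonneg fun P => integral_nonneg fun x => ?_)
    (mul_pos (sub_pos.2 hlu) hε)
  exact ENNReal.toReal_nonneg

theorem bet_pos {𝒩 : Set (Measure 𝒳)} {ε : ℝ} (hε : 0 < ε)
    (hl : 0 < lowerThreshold μ ε p₀ p₁)
    (hlu : lowerThreshold μ ε p₀ p₁ < upperThreshold μ ε p₀ p₁) (x : 𝒳) :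
    0 < bet μ 𝒩 ε p₀ p₁ x :=
  div_pos (truncRatio_pos hl x) (normalizer_pos hε hlu)

theorem measurable_truncRatio {ε : ℝ} (h0 : Measurable p₀) (h1 : Measurable p₁) :
    Measurable (truncRatio μ ε p₀ p₁) :=
  (measurable_const.max (measurable_const.min (h1.div h0))).ennreal_toReal

end thresholds

/-! ### Uniqueness of the numeraire -/

/-- Testing each numeraire against the other gives `E[B/B' + B'/B] ≤ 2`. The integrand is at least
`2`, with equality only where `B = B'`. -/
theorem IsNumeraire.ae_eq {𝒩 : Set (Measure 𝒳)} {P₁ : Measure 𝒳} [IsProbabilityMeasure P₁]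
    {B B' : 𝒳 → ℝ≥0∞} (hB : IsNumeraire 𝒩 P₁ B) (hB' : IsNumeraire 𝒩 P₁ B')
    (hfin : ∀ᵐ x ∂P₁, B x < ∞) (hfin' : ∀ᵐ x ∂P₁, B' x < ∞) : B =ᵐ[P₁] B' := by
  have key : ∀ a b : ℝ, 0 < a → 0 < b → 2 ≤ a / b + b / a ∧ (2 = a / b + b / a → a = b) := by
    intro a b ha hb
    have e : a / b + b / a - 2 = (a - b) ^ 2 / (a * b) := by field_simp; ring
    refine ⟨by have : 0 ≤ (a - b) ^ 2 / (a * b) := by positivity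
               linarith, fun h => ?_⟩
    rw [← h, sub_self, eq_comm, div_eq_zero_iff] at e
    rcases e with e | e
    · have := pow_eq_zero_iff (two_ne_zero) |>.1 e
      linarith
    · exact absurd e (mul_pos ha hb).ne'
  have hconv : ∀ᵐ x ∂P₁, ∃ a b : ℝ, 0 < a ∧ 0 < b ∧ B x = ENNReal.ofReal a ∧
      B' x = ENNReal.ofReal b ∧
      B x / B' x + B' x / B x = ENNReal.ofReal (a / b + b / a) := by
    filter_upwards [hB.2.1, hB'.2.1, hfin, hfin'] with x h1 h2 h3 h4
    have ha := ENNReal.toReal_pos h1.ne' h3.ne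
    have hb := ENNReal.toReal_pos h2.ne' h4.ne
    refine ⟨_, _, ha, hb, (ENNReal.ofReal_toReal h3.ne).symm, (ENNReal.ofReal_toReal h4.ne).symm, ?_⟩
    rw [ENNReal.ofReal_add (by positivity) (by positivity), ENNReal.ofReal_div_of_pos hb,
      ENNReal.ofReal_div_of_pos ha, ENNReal.ofReal_toReal h3.ne, ENNReal.ofReal_toReal h4.ne]
  have hle : (fun _ => (2 : ℝ≥0∞)) ≤ᵐ[P₁] fun x => B x / B' x + B' x / B x := by
    filter_upwards [hconv] with x ⟨a, b, ha, hb, _, _, h⟩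
    rw [h, ← ENNReal.ofReal_ofNat]
    exact ENNReal.ofReal_le_ofReal (key a b ha hb).1
  have hm₁ : Measurable fun x => B x / B' x := hB.1.1.div hB'.1.1
  have hm : Measurable fun x => B x / B' x + B' x / B x := hm₁.add (hB'.1.1.div hB.1.1)
  have hint : ∫⁻ x, (B x / B' x + B' x / B x) ∂P₁ ≤ ∫⁻ _, 2 ∂P₁ := by
    rw [lintegral_add_left hm₁, lintegral_const, measure_univ, mul_one]
    exact (add_le_add (hB'.2.2 B hB.1) (hB.2.2 B' hB'.1)).trans_eq one_add_one_eq_two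
  have heq := ae_eq_of_ae_le_of_lintegral_le hle (by simp) hm.aemeasurable hint
  filter_upwards [heq, hconv] with x hx ⟨a, b, ha, hb, h1, h2, h⟩
  rw [h, ← ENNReal.ofReal_ofNat, ENNReal.ofReal_eq_ofReal_iff (by norm_num) (by positivity)] at hx
  rw [h1, h2, (key a b ha hb).2 hx]

namespace ExpFamily

variable (F : ExpFamily 𝒳)

/-! ### Densities of an exponential family -/

/-- The real-valued density `p_θ`. -/
def dens (θ : ℝ) (x : 𝒳) : ℝ := F.h x * Real.exp (θ * F.T x - F.A θ)

/-- The logarithm of `p_θ / p_t`. -/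
def logRatio (θ t : ℝ) (x : 𝒳) : ℝ := (θ - t) * F.T x + (F.A t - F.A θ)

theorem measurable_logRatio (θ t : ℝ) : Measurable (F.logRatio θ t) :=
  (F.measurable_T.const_mul _).add_const _

theorem measurable_dens (θ : ℝ) : Measurable (F.dens θ) :=
  F.measurable_h.mul (Real.measurable_exp.comp ((F.measurable_T.const_mul _).sub_const _))

theorem measurable_p (θ : ℝ) : Measurable (F.p θ) := (F.measurable_dens θ).ennreal_ofReal

theorem dens_nonneg (θ : ℝ) (x : 𝒳) : 0 ≤ F.dens θ x :=
  mul_nonneg (F.h_nonneg x) (Real.exp_pos _).le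

theorem p_eq_ofReal (θ : ℝ) (x : 𝒳) : F.p θ x = ENNReal.ofReal (F.dens θ x) := rfl

theorem toReal_p (θ : ℝ) (x : 𝒳) : (F.p θ x).toReal = F.dens θ x :=
  ENNReal.toReal_ofReal (F.dens_nonneg θ x)

theorem p_ne_top (θ : ℝ) (x : 𝒳) : F.p θ x ≠ ∞ := ENNReal.ofReal_ne_top

theorem lintegral_p (θ : ℝ) : ∫⁻ x, F.p θ x ∂F.μ = 1 := F.lintegral_density θ

theorem lintegral_p_ne_top (θ : ℝ) : ∫⁻ x, F.p θ x ∂F.μ ≠ ∞ := by simp [F.lintegral_p]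

theorem integrable_dens (θ : ℝ) : Integrable (F.dens θ) F.μ := by
  have := integrable_toReal_of_lintegral_ne_top (F.measurable_p θ).aemeasurable
    (F.lintegral_p_ne_top θ)
  simpa only [toReal_p] using this

theorem integral_dens (θ : ℝ) : ∫ x, F.dens θ x ∂F.μ = 1 := by
  have := integral_toReal (F.measurable_p θ).aemeasurable
    (ae_lt_top (F.measurable_p θ) (F.lintegral_p_ne_top θ))
  simpa only [toReal_p, F.lintegral_p, ENNReal.toReal_one] using this

instance isProbabilityMeasure_P (θ : ℝ) : IsProbabilityMeasure (F.P θ) :=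
  ⟨by rw [P, withDensity_apply _ MeasurableSet.univ, setLIntegral_univ, lintegral_p]⟩

theorem dens_eq_mul_exp (θ t : ℝ) (x : 𝒳) :
    F.dens θ x = F.dens t x * Real.exp (F.logRatio θ t x) := by
  rw [dens, dens, mul_assoc, ← Real.exp_add, logRatio]
  ring_nf

theorem p_eq_mul (θ t : ℝ) (x : 𝒳) :
    F.p θ x = F.p t x * ENNReal.ofReal (Real.exp (F.logRatio θ t x)) := by
  rw [p_eq_ofReal, p_eq_ofReal, ← ENNReal.ofReal_mul (F.dens_nonneg t x), ← dens_eq_mul_exp]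

theorem measurable_expRatio (θ t : ℝ) :
    Measurable fun x => ENNReal.ofReal (Real.exp (F.logRatio θ t x)) :=
  (Real.measurable_exp.comp (F.measurable_logRatio θ t)).ennreal_ofReal

theorem P_eq_withDensity (θ t : ℝ) :
    F.P θ = (F.P t).withDensity fun x => ENNReal.ofReal (Real.exp (F.logRatio θ t x)) := by
  rw [P, P, ← withDensity_mul _ (F.measurable_p t) (F.measurable_expRatio θ t)]
  congr 1
  ext x
  exact F.p_eq_mul θ t x

theorem P_absolutelyContinuous (θ t : ℝ) : F.P θ ≪ F.P t := by
  rw [F.P_eq_withDensity θ t]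
  exact withDensity_absolutelyContinuous _ _

/-- The likelihood ratio, with the convention `0 / 0 = 0`. -/
def ratio (θ t : ℝ) (x : 𝒳) : ℝ := if F.h x = 0 then 0 else Real.exp (F.logRatio θ t x)

theorem p_div_p (θ t : ℝ) (x : 𝒳) : F.p θ x / F.p t x = ENNReal.ofReal (F.ratio θ t x) := by
  rw [ratio]
  split_ifs with h
  · simp [p_eq_ofReal, dens, h]
  · have ht : F.p t x ≠ 0 := by
      have : 0 < F.h x := lt_of_le_of_ne (F.h_nonneg x) (Ne.symm h)
      rw [p_eq_ofReal, Ne, ENNReal.ofReal_eq_zero, not_le, dens]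
      positivity
    rw [F.p_eq_mul θ t, mul_comm, ENNReal.mul_div_cancel_right ht (F.p_ne_top t x)]

theorem ae_h_ne_zero (θ : ℝ) : ∀ᵐ x ∂F.P θ, F.h x ≠ 0 := by
  rw [P, ae_withDensity_iff (F.measurable_p θ)]
  refine ae_of_all _ fun x hx h => hx ?_
  simp [p_eq_ofReal, dens, h]

theorem integrable_P_iff (θ : ℝ) {φ : 𝒳 → ℝ} :
    Integrable φ (F.P θ) ↔ Integrable (fun x => F.dens θ x * φ x) F.μ := by
  rw [P, integrable_withDensity_iff_integrable_smul' (F.measurable_p θ)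
    (ae_of_all _ fun x => (F.p_ne_top θ x).lt_top)]
  simp only [toReal_p, smul_eq_mul]

theorem integral_P (θ : ℝ) (φ : 𝒳 → ℝ) :
    ∫ x, φ x ∂F.P θ = ∫ x, F.dens θ x * φ x ∂F.μ := by
  rw [P, integral_withDensity_eq_integral_toReal_smul (F.measurable_p θ)
    (ae_of_all _ fun x => (F.p_ne_top θ x).lt_top)]
  simp only [toReal_p, smul_eq_mul]

theorem integrable_exp_logRatio (θ t : ℝ) :
    Integrable (fun x => Real.exp (F.logRatio θ t x)) (F.P t) := by
  rw [integrable_P_iff]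
  exact (F.integrable_dens θ).congr (ae_of_all _ fun x => F.dens_eq_mul_exp θ t x)

/-- All exponential moments of `T` are finite because every real number is a parameter, and `|T| ≤
exp T + exp (-T)`. -/
theorem integrable_T (θ : ℝ) : Integrable F.T (F.P θ) := by
  have h : ∀ s, Integrable (fun x => Real.exp (s * F.T x)) (F.P θ) := by
    intro s
    refine ((F.integrable_exp_logRatio (θ + s) θ).const_mul
      (Real.exp (F.A (θ + s) - F.A θ))).congr (ae_of_all _ fun x => ?_)
    simp only [logRatio]
    rw [← Real.exp_add]
    ring_nf
  refine ((h 1).add (h (-1))).mono' F.measurable_T.aestronglyMeasurable (ae_of_all _ fun x => ?_)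
  simp only [Pi.add_apply, Real.norm_eq_abs, one_mul, neg_mul]
  have h1 := Real.add_one_le_exp (F.T x)
  have h2 := Real.add_one_le_exp (-F.T x)
  have h3 := Real.exp_pos (F.T x)
  have h4 := Real.exp_pos (-F.T x)
  exact abs_le.2 ⟨by linarith, by linarith⟩

theorem integrable_logRatio (θ t s : ℝ) : Integrable (F.logRatio θ t) (F.P s) :=
  ((F.integrable_T s).const_mul _).add (integrable_const _)

/-- Tilting `P_s` by `p_θ/p_t` gives a constant multiple of `P_{s+θ-t}`, which has mass one. -/
theorem lintegral_expRatio (θ t s : ℝ) :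
    ∫⁻ x, ENNReal.ofReal (Real.exp (F.logRatio θ t x)) ∂F.P s
      = ENNReal.ofReal (Real.exp (F.A (s + θ - t) + F.A t - (F.A s + F.A θ))) := by
  have : ∀ x, ENNReal.ofReal (Real.exp (F.logRatio θ t x))
      = ENNReal.ofReal (Real.exp (F.A (s + θ - t) + F.A t - (F.A s + F.A θ)))
        * ENNReal.ofReal (Real.exp (F.logRatio (s + θ - t) s x)) := by
    intro x
    rw [← ENNReal.ofReal_mul (Real.exp_pos _).le, ← Real.exp_add, logRatio, logRatio]
    ring_nf
  simp_rw [this]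
  rw [lintegral_const_mul _ (F.measurable_expRatio _ _), ← setLIntegral_univ,
    ← withDensity_apply _ MeasurableSet.univ, ← P_eq_withDensity, measure_univ, mul_one]

/-! ### The reverse information projection -/

/-- `s ∈ Θ₀` separates `θ` from the rest of `Θ₀`. -/
def Separates (Θ₀ : Set ℝ) (s θ : ℝ) : Prop :=
  s ∈ Θ₀ ∧ θ ≠ s ∧ ∀ t ∈ Θ₀, 0 ≤ (t - s) * (s - θ)

theorem separates_of_extremal {Θ₀ : Set ℝ} {θ : ℝ}
    (h : (∃ s, IsLeast Θ₀ s ∧ θ < s) ∨ (∃ s, IsGreatest Θ₀ s ∧ s < θ)) :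
    ∃ s, Separates Θ₀ s θ := by
  rcases h with ⟨s, hs, h⟩ | ⟨s, hs, h⟩
  · exact ⟨s, hs.1, h.ne, fun t ht => mul_nonneg (sub_nonneg.2 (hs.2 ht)) (sub_nonneg.2 h.le)⟩
  · exact ⟨s, hs.1, h.ne', fun t ht =>
      mul_nonneg_of_nonpos_of_nonpos (sub_nonpos.2 (hs.2 ht)) (sub_nonpos.2 h.le)⟩

theorem Separates.eventually {Θ₀ : Set ℝ} {s θ : ℝ} (h : Separates Θ₀ s θ) :
    ∀ᶠ θ' in 𝓝 θ, Separates Θ₀ s θ' := by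
  rcases lt_or_gt_of_ne h.2.1 with hlt | hlt
  · filter_upwards [eventually_lt_nhds hlt] with θ' hθ'
    refine ⟨h.1, hθ'.ne, fun t ht => mul_nonneg ?_ (sub_nonneg.2 hθ'.le)⟩
    exact nonneg_of_mul_nonneg_left (h.2.2 t ht) (sub_pos.2 hlt)
  · filter_upwards [eventually_gt_nhds hlt] with θ' hθ'
    refine ⟨h.1, hθ'.ne', fun t ht => mul_nonneg_of_nonpos_of_nonpos ?_ (sub_nonpos.2 hθ'.le)⟩
    have := h.2.2 t ht
    by_contra hc
    exact absurd this (not_le.2 (mul_neg_of_pos_of_neg (not_le.1 hc) (sub_neg.2 hlt)))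

variable {F}

/-- The sign condition puts `s` between `θ` and `t`. Then `s` and `t + θ - s` are convex
combinations of `θ` and `t` with exchanged weights, and the two convexity inequalities add up. -/
theorem A_add_le (hconv : ConvexOn ℝ Set.univ F.A) {s θ t : ℝ} (hne : θ ≠ s)
    (h : 0 ≤ (t - s) * (s - θ)) : F.A (t + θ - s) + F.A s ≤ F.A t + F.A θ := by
  have hd : t - θ ≠ 0 := by
    intro h0
    have : t = θ := by linarith
    subst this
    have : 0 < (t - s) ^ 2 := by
      have : t - s ≠ 0 := sub_ne_zero.2 hne
      positivity
    nlinarith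
  have h0 : 0 ≤ (s - θ) / (t - θ) := by
    rw [div_nonneg_iff]
    rcases lt_or_gt_of_ne hne with hlt | hlt
    · left
      have : 0 ≤ t - s := nonneg_of_mul_nonneg_left h (sub_pos.2 hlt)
      constructor <;> linarith
    · right
      have : t - s ≤ 0 := by
        by_contra hc
        nlinarith [mul_pos (not_le.1 hc) (sub_pos.2 hlt)]
      constructor <;> linarith
  have h1 : (s - θ) / (t - θ) ≤ 1 := by
    have : 0 ≤ (t - s) / (t - θ) := by
      have e : (t - s) / (t - θ) = ((t - s) * (s - θ) + (t - s) ^ 2) / (t - θ) ^ 2 := by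
        field_simp
        ring
      rw [e]
      positivity
    have e : (s - θ) / (t - θ) = 1 - (t - s) / (t - θ) := by
      field_simp
      ring
    linarith
  -- The weight for which `s = l t + (1 - l) θ`.
  set l := (s - θ) / (t - θ) with hl
  have hls : l * (t - θ) = s - θ := by rw [hl]; field_simp
  have c1 := hconv.2 (Set.mem_univ t) (Set.mem_univ θ) h0 (sub_nonneg.2 h1) (by ring)
  have c2 := hconv.2 (Set.mem_univ θ) (Set.mem_univ t) h0 (sub_nonneg.2 h1) (by ring)
  simp only [smul_eq_mul] at c1 c2
  have e1 : l * t + (1 - l) * θ = s := by linarith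
  have e2 : l * θ + (1 - l) * t = t + θ - s := by linarith
  rw [e1] at c1
  rw [e2] at c2
  linarith

/-- The e-variable bound is convexity of `A`. For optimality, dividing by `p_θ/p_s` under `P_θ` is
integrating under `P_s`, a member of the null, where every e-variable has mean at most `1`. -/
theorem isNumeraire_expRatio (hconv : ConvexOn ℝ Set.univ F.A) {Θ₀ : Set ℝ} {s θ : ℝ}
    (h : Separates Θ₀ s θ) :
    IsNumeraire (F.family Θ₀) (F.P θ) fun x => ENNReal.ofReal (Real.exp (F.logRatio θ s x)) := by
  refine ⟨⟨F.measurable_expRatio θ s, ?_⟩, ae_of_all _ fun x => ?_, fun B' hB' => ?_⟩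
  · rintro _ ⟨t, ht, rfl⟩
    rw [lintegral_expRatio, ENNReal.ofReal_le_one, Real.exp_le_one_iff]
    linarith [A_add_le hconv h.2.1 (h.2.2 t ht)]
  · simpa using Real.exp_pos _
  · have hm : Measurable fun x => B' x / ENNReal.ofReal (Real.exp (F.logRatio θ s x)) :=
      hB'.1.div (F.measurable_expRatio θ s)
    rw [F.P_eq_withDensity θ s,
      lintegral_withDensity_eq_lintegral_mul _ (F.measurable_expRatio θ s) hm]
    refine le_trans (le_of_eq (lintegral_congr fun x => ?_)) (hB'.2 _ ⟨s, h.1, rfl⟩)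
    simp only [Pi.mul_apply]
    exact ENNReal.mul_div_cancel (by simpa using Real.exp_pos _) ENNReal.ofReal_ne_top

theorem P_eq_withDensity_inv (θ t : ℝ) :
    F.P t = (F.P θ).withDensity fun x => (ENNReal.ofReal (Real.exp (F.logRatio θ t x)))⁻¹ := by
  rw [F.P_eq_withDensity t θ]
  congr 1
  ext x
  rw [← ENNReal.ofReal_inv_of_pos (Real.exp_pos _), ← Real.exp_neg, logRatio, logRatio]
  ring_nf

theorem isRIPr_P (hconv : ConvexOn ℝ Set.univ F.A) {Θ₀ : Set ℝ} {s θ : ℝ}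
    (h : Separates Θ₀ s θ) : IsRIPr (F.family Θ₀) (F.P θ) (F.P s) :=
  ⟨_, isNumeraire_expRatio hconv h, P_eq_withDensity_inv θ s⟩

theorem IsEVariable.ae_lt_top {Θ₀ : Set ℝ} {s : ℝ} (hs : s ∈ Θ₀) (θ : ℝ) {B : 𝒳 → ℝ≥0∞}
    (hB : IsEVariable (F.family Θ₀) B) : ∀ᵐ x ∂F.P θ, B x < ∞ :=
  (F.P_absolutelyContinuous θ s).ae_le
    (MeasureTheory.ae_lt_top hB.1 ((hB.2 _ ⟨s, hs, rfl⟩).trans_lt ENNReal.one_lt_top).ne)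

theorem P_eq_of_isRIPr (hconv : ConvexOn ℝ Set.univ F.A) {Θ₀ : Set ℝ} {s θ t : ℝ}
    (h : Separates Θ₀ s θ) (ht : IsRIPr (F.family Θ₀) (F.P θ) (F.P t)) : F.P t = F.P s := by
  obtain ⟨B, hB, hBt⟩ := ht
  have hN := isNumeraire_expRatio hconv h
  have := hB.ae_eq hN (IsEVariable.ae_lt_top h.1 θ hB.1) (IsEVariable.ae_lt_top h.1 θ hN.1)
  rw [hBt, P_eq_withDensity_inv θ s]
  refine withDensity_congr_ae ?_
  filter_upwards [this] with x hx
  rw [hx]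

/-- The density is defined by choice, so the chosen parameter `t` need not be `s`; uniqueness of the
numeraire only identifies the distributions. -/
theorem riprDensity_spec (hconv : ConvexOn ℝ Set.univ F.A) {Θ₀ : Set ℝ} {s θ : ℝ}
    (h : Separates Θ₀ s θ) : ∃ t ∈ Θ₀, F.riprDensity Θ₀ θ = F.p t ∧ F.P t = F.P s ∧
      IsRIPr (F.family Θ₀) (F.P θ) (F.P t) := by
  have H : ∃ t ∈ Θ₀, IsRIPr (F.family Θ₀) (F.P θ) (F.P t) := ⟨s, h.1, isRIPr_P hconv h⟩
  exact ⟨H.choose, H.choose_spec.1, by rw [riprDensity, dif_pos H],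
    P_eq_of_isRIPr hconv h H.choose_spec.2, H.choose_spec.2⟩

/-- If two different parameters give the same distribution, then all densities agree. -/
theorem p_ae_eq_of_P_eq {t s : ℝ} (hts : t ≠ s) (h : F.P t = F.P s) (θ η : ℝ) :
    F.p θ =ᵐ[F.μ] F.p η := by
  have h1 : F.p t =ᵐ[F.μ] F.p s := (withDensity_eq_iff (F.measurable_p t).aemeasurable
    (F.measurable_p s).aemeasurable (F.lintegral_p_ne_top t)).1 h
  -- Equality of the two exponents is a linear equation in `T`, so `T` equals `τ` almost everywhere
  -- that `h ≠ 0`. All densities are then proportional, and their common mass makes the factor `k`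
  -- equal to `1`.
  set τ := (F.A t - F.A s) / (t - s) with hτ
  have hT : ∀ᵐ x ∂F.μ, F.h x ≠ 0 → F.T x = τ := by
    filter_upwards [h1] with x hx hh
    have hd : F.dens t x = F.dens s x := by rw [← toReal_p, hx, toReal_p]
    have h2 : t * F.T x - F.A t = s * F.T x - F.A s := Real.exp_injective (mul_left_cancel₀ hh hd)
    rw [hτ, eq_div_iff (sub_ne_zero.2 hts)]
    linarith
  set k := Real.exp ((θ - η) * τ + (F.A η - F.A θ)) with hk
  have h3 : F.dens θ =ᵐ[F.μ] fun x => F.dens η x * k := by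
    filter_upwards [hT] with x hx
    by_cases hh : F.h x = 0
    · simp [dens, hh]
    · rw [F.dens_eq_mul_exp θ η, logRatio, hx hh]
  have h4 : k = 1 := by
    have := integral_congr_ae h3
    rwa [integral_mul_const, integral_dens, integral_dens, one_mul, eq_comm] at this
  filter_upwards [h3] with x hx
  rw [p_eq_ofReal, p_eq_ofReal, hx, h4, mul_one]

theorem maxMass_of_ae_eq {t θ : ℝ} (h : F.p t =ᵐ[F.μ] F.p θ) (c : ℝ) :
    maxMass F.μ (F.dens t) (F.dens θ) c = max 1 c := by
  have : ∀ᵐ x ∂F.μ, max (F.dens t x) (c * F.dens θ x) = F.dens t x * max 1 c := by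
    filter_upwards [h] with x hx
    have hd : F.dens t x = F.dens θ x := by rw [← toReal_p, hx, toReal_p]
    rw [← hd, mul_max_of_nonneg _ _ (F.dens_nonneg t x), mul_one, mul_comm]
  rw [maxMass, integral_congr_ae this, integral_mul_const, integral_dens, one_mul]

/-! ### Thresholds within an exponential family. -/

theorem lower_spec (t θ : ℝ) {ε : ℝ} (hε : 0 < ε) (hε1 : ε < 1) :
    0 < lowerThreshold F.μ ε (F.p t) (F.p θ) ∧
      maxMass F.μ (F.dens θ) (F.dens t) (lowerThreshold F.μ ε (F.p t) (F.p θ)) = (1 - ε)⁻¹ := by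
  have := lowerThreshold_spec (F.measurable_p t) (F.measurable_p θ) (F.lintegral_p_ne_top t)
    (by simp [F.lintegral_p]) (F.lintegral_p θ) hε hε1
  simpa only [toReal_p] using this

theorem upper_spec (t θ : ℝ) {ε : ℝ} (hε : 0 < ε) (hε1 : ε < 1) :
    0 < upperThreshold F.μ ε (F.p t) (F.p θ) ∧
      maxMass F.μ (F.dens t) (F.dens θ) (upperThreshold F.μ ε (F.p t) (F.p θ))⁻¹ = (1 - ε)⁻¹ := by
  have := upperThreshold_spec (F.measurable_p t) (F.measurable_p θ) (F.lintegral_p t)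
    (F.lintegral_p θ) hε hε1
  simpa only [toReal_p] using this

/-- When the two densities agree, both equations read `max 1 c = (1 - ε)⁻¹ > 1`, so `c''` is below
`1` and `c'` above it. Hence `c' < c''` excludes this degenerate case. -/
theorem upper_le_lower_of_ae_eq {t θ : ℝ} (h : F.p t =ᵐ[F.μ] F.p θ) {ε : ℝ} (hε : 0 < ε)
    (hε1 : ε < 1) :
    upperThreshold F.μ ε (F.p t) (F.p θ) ≤ lowerThreshold F.μ ε (F.p t) (F.p θ) := by
  obtain ⟨hl, hl'⟩ := F.lower_spec t θ hε hε1
  obtain ⟨hu, hu'⟩ := F.upper_spec t θ hε hε1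
  rw [maxMass_of_ae_eq h.symm] at hl'
  rw [maxMass_of_ae_eq h] at hu'
  have he : 1 < (1 - ε)⁻¹ := (one_lt_inv₀ (by linarith)).2 (by linarith)
  have h1 : 1 < lowerThreshold F.μ ε (F.p t) (F.p θ) := by
    by_contra hc
    rw [max_eq_left (not_lt.1 hc)] at hl'
    linarith
  have h2 : 1 < (upperThreshold F.μ ε (F.p t) (F.p θ))⁻¹ := by
    by_contra hc
    rw [max_eq_left (not_lt.1 hc)] at hu'
    linarith
  exact ((one_lt_inv₀ hu).1 h2).le.trans h1.le

/-- Under `c' < c''` the density of the projection is the density at the extremal parameter. -/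
theorem riprDensity_eq (hconv : ConvexOn ℝ Set.univ F.A) {Θ₀ : Set ℝ} {s θ₁ : ℝ}
    (h₁ : Separates Θ₀ s θ₁) {ε : ℝ} (hε : 0 < ε) (hε1 : ε < 1)
    (hlu : F.cLower Θ₀ ε θ₁ < F.cUpper Θ₀ ε θ₁) {θ : ℝ} (h : Separates Θ₀ s θ) :
    F.riprDensity Θ₀ θ = F.p s := by
  obtain ⟨t₁, -, ht₁, -, -⟩ := riprDensity_spec hconv h₁
  obtain ⟨t, -, ht, hP, -⟩ := riprDensity_spec hconv h
  by_cases hts : t = s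
  · rw [ht, hts]
  -- If choice picks `t ≠ s`, the family has only one distribution, which contradicts `c' < c''`.
  · refine absurd hlu (not_lt.2 ?_)
    rw [cUpper, cLower, ht₁]
    exact upper_le_lower_of_ae_eq (p_ae_eq_of_P_eq hts hP t₁ θ₁) hε hε1

/-- The lower threshold is positive for every alternative. -/
theorem cLower_pos {Θ₀ : Set ℝ} (hne : Θ₀.Nonempty) (θ : ℝ) {ε : ℝ} (hε : 0 < ε) (hε1 : ε < 1) :
    0 < F.cLower Θ₀ ε θ := by
  rw [cLower, riprDensity]
  split_ifs with H H'
  · exact (F.lower_spec _ θ hε hε1).1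
  · obtain ⟨s, hs⟩ := hne
    have hB := H'.choose_spec
    set B := H'.choose
    have hm : Measurable fun x => 1 / B x := measurable_const.div hB.1.1
    have hm' : Measurable fun x => F.p θ x / B x := (F.measurable_p θ).div hB.1.1
    have hle : ∫⁻ x, F.p θ x / B x ∂F.μ = ∫⁻ x, 1 / B x ∂F.P θ := by
      rw [P, lintegral_withDensity_eq_lintegral_mul _ (F.measurable_p θ) hm]
      refine lintegral_congr fun x => ?_
      simp [div_eq_mul_inv]
    refine (lowerThreshold_spec hm' (F.measurable_p θ) ?_ ?_
      (F.lintegral_p θ) hε hε1).1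
    -- The constant `1` is an e-variable, so the projection has mass at most one; below, its mass is
    -- nonzero because `B` is almost surely finite.
    · rw [hle]
      refine ((hB.2.2 (fun _ => 1) ⟨measurable_const, ?_⟩).trans_lt ENNReal.one_lt_top).ne
      rintro _ ⟨t, -, rfl⟩
      simp
    · rw [hle]
      intro h0
      rw [lintegral_eq_zero_iff hm] at h0
      have : ∀ᵐ x ∂F.P θ, False := by
        filter_upwards [h0, IsEVariable.ae_lt_top hs θ hB.1] with x hx hx'
        simp at hx
        exact hx'.ne hx
      simp at this
      exact IsProbabilityMeasure.ne_zero (F.P θ) this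
  · exact (F.lower_spec _ θ hε hε1).1

/-! ### The truncated likelihood ratio of an exponential family -/

theorem truncRatio_eq {ε : ℝ} (hε : 0 < ε) (hε1 : ε < 1) (t θ : ℝ) (x : 𝒳) :
    truncRatio F.μ ε (F.p t) (F.p θ) x =
      max (lowerThreshold F.μ ε (F.p t) (F.p θ))
        (min (upperThreshold F.μ ε (F.p t) (F.p θ)) (F.ratio θ t x)) := by
  have hl := (F.lower_spec t θ hε hε1).1
  have hu := (F.upper_spec t θ hε hε1).1
  rw [truncRatio, p_div_p, ← ENNReal.ofReal_min, ← ENNReal.ofReal_max,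
    ENNReal.toReal_ofReal (le_max_of_le_left hl.le)]

theorem lower_le_truncRatio {ε : ℝ} (hε : 0 < ε) (hε1 : ε < 1) (t θ : ℝ) (x : 𝒳) :
    lowerThreshold F.μ ε (F.p t) (F.p θ) ≤ truncRatio F.μ ε (F.p t) (F.p θ) x := by
  rw [truncRatio_eq hε hε1]
  exact le_max_left _ _

theorem truncRatio_le {ε : ℝ} (hε : 0 < ε) (hε1 : ε < 1) (t θ : ℝ) (x : 𝒳) :
    truncRatio F.μ ε (F.p t) (F.p θ) x ≤
      max (lowerThreshold F.μ ε (F.p t) (F.p θ)) (upperThreshold F.μ ε (F.p t) (F.p θ)) := by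
  rw [truncRatio_eq hε hε1]
  exact max_le_max le_rfl (min_le_left _ _)

theorem measurable_truncRatio_p (ε t θ : ℝ) : Measurable (truncRatio F.μ ε (F.p t) (F.p θ)) :=
  measurable_truncRatio (F.measurable_p t) (F.measurable_p θ)

theorem integrable_truncRatio {ε : ℝ} (hε : 0 < ε) (hε1 : ε < 1) (t θ : ℝ) (Q : Measure 𝒳)
    [IsFiniteMeasure Q] : Integrable (truncRatio F.μ ε (F.p t) (F.p θ)) Q := by
  refine Integrable.of_bound (measurable_truncRatio_p ε t θ).aestronglyMeasurable
    (max (lowerThreshold F.μ ε (F.p t) (F.p θ)) (upperThreshold F.μ ε (F.p t) (F.p θ)))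
    (ae_of_all _ fun x => ?_)
  rw [Real.norm_of_nonneg ((F.lower_spec t θ hε hε1).1.le.trans
    (lower_le_truncRatio hε hε1 t θ x))]
  exact truncRatio_le hε hε1 t θ x

/-- Monotone likelihood ratio: the expectation of the truncated likelihood ratio over the null is
largest at the extremal parameter. -/
theorem integral_truncRatio_le {Θ₀ : Set ℝ} {s θ t u : ℝ} (h : Separates Θ₀ s θ) (ht : t ∈ Θ₀)
    (hu : u ∈ Θ₀) {ε : ℝ} (hε : 0 < ε) (hε1 : ε < 1) :
    ∫ x, truncRatio F.μ ε (F.p t) (F.p θ) x ∂F.P u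
      ≤ ∫ x, truncRatio F.μ ε (F.p t) (F.p θ) x ∂F.P s := by
  rcases eq_or_ne u s with rfl | hus
  · exact le_rfl
  set l := lowerThreshold F.μ ε (F.p t) (F.p θ)
  set v := upperThreshold F.μ ε (F.p t) (F.p θ)
  set π := truncRatio F.μ ε (F.p t) (F.p θ) with hπ
  -- `τ` is the value of `T` at which `p_u` and `p_s` cross, and `k` below is the truncated ratio
  -- there. Since that ratio and `p_u/p_s` move in opposite directions as `T` grows, `(p_u - p_s)(π
  -- - k) ≤ 0` pointwise. After integration `k` cancels, both measures having mass one.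
  set τ := (F.A u - F.A s) / (u - s) with hτ
  have hus' : u - s ≠ 0 := sub_ne_zero.2 hus
  set k := max l (min v (Real.exp ((θ - t) * τ + (F.A t - F.A θ)))) with hk
  have hsign : (θ - t) * (u - s) ≤ 0 := by
    have h1 := h.2.2 u hu
    have h2 := h.2.2 t ht
    rcases lt_or_gt_of_ne h.2.1 with hlt | hlt
    · have h1' := nonneg_of_mul_nonneg_left h1 (sub_pos.2 hlt)
      have h2' := nonneg_of_mul_nonneg_left h2 (sub_pos.2 hlt)
      exact mul_nonpos_of_nonpos_of_nonneg (by linarith) h1'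
    · have aux : ∀ y : ℝ, 0 ≤ y * (s - θ) → y ≤ 0 := fun y hy => by
        by_contra hc
        nlinarith [mul_pos (not_le.1 hc) (sub_pos.2 hlt)]
      have h1' := aux _ h1
      have h2' := aux _ h2
      exact mul_nonpos_of_nonneg_of_nonpos (by linarith) h1'
  have hLR : ∀ x, F.logRatio u s x = (u - s) * (F.T x - τ) := fun x => by
    rw [logRatio, hτ]
    field_simp
    ring
  have hprod : ∀ x, F.logRatio u s x * ((θ - t) * (F.T x - τ)) ≤ 0 := fun x => by
    rw [hLR]
    nlinarith [mul_nonneg (neg_nonneg.2 hsign) (sq_nonneg (F.T x - τ))]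
  have hpt : ∀ x, F.dens u x * (π x - k) ≤ F.dens s x * (π x - k) := by
    intro x
    by_cases hh : F.h x = 0
    · simp [dens, hh]
    have hπx : π x = max l (min v (Real.exp ((θ - t) * F.T x + (F.A t - F.A θ)))) := by
      rw [hπ, truncRatio_eq hε hε1, ratio, if_neg hh, logRatio]
    rw [F.dens_eq_mul_exp u s, mul_assoc]
    refine mul_le_mul_of_nonneg_left ?_ (F.dens_nonneg s x)
    rcases le_total 0 (F.logRatio u s x) with hpos | hneg
    · have hle : π x ≤ k := by
        rcases hpos.eq_or_lt with h0 | h0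
        · have : F.T x = τ := by
            rw [hLR] at h0
            rcases mul_eq_zero.1 h0.symm with h0 | h0
            · exact absurd h0 hus'
            · linarith
          rw [hπx, this]
        · have h3 : (θ - t) * (F.T x - τ) ≤ 0 := by
            by_contra hc
            exact absurd (hprod x) (not_le.2 (mul_pos h0 (not_le.1 hc)))
          rw [hπx, hk]
          gcongr max l (min v (Real.exp ?_))
          linarith
      have := Real.one_le_exp hpos
      nlinarith
    · have hle : k ≤ π x := by
        rcases hneg.eq_or_lt with h0 | h0
        · have : F.T x = τ := by
            rw [hLR] at h0
            rcases mul_eq_zero.1 h0 with h0 | h0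
            · exact absurd h0 hus'
            · linarith
          rw [hπx, this]
        · have h3 : 0 ≤ (θ - t) * (F.T x - τ) := by
            by_contra hc
            exact absurd (hprod x) (not_le.2 (mul_pos_of_neg_of_neg h0 (not_le.1 hc)))
          rw [hπx, hk]
          gcongr max l (min v (Real.exp ?_))
          linarith
      have := Real.exp_le_one_iff.2 hneg
      nlinarith
  have hint : ∀ a, Integrable (fun x => π x - k) (F.P a) := fun a =>
    (integrable_truncRatio hε hε1 t θ (F.P a)).sub (integrable_const k)
  have := integral_mono ((F.integrable_P_iff u).1 (hint u)) ((F.integrable_P_iff s).1 (hint s)) hpt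
  rw [← integral_P, ← integral_P, integral_sub (integrable_truncRatio hε hε1 t θ _)
    (integrable_const k), integral_sub (integrable_truncRatio hε hε1 t θ _)
    (integrable_const k)] at this
  simpa using this

/-- Reduces the continuity and the small-`ε` limit of the normaliser to a single integral instead of
a supremum. -/
theorem normalizer_eq {Θ₀ : Set ℝ} {s θ t : ℝ} (h : Separates Θ₀ s θ) (ht : t ∈ Θ₀)
    {ε : ℝ} (hε : 0 < ε) (hε1 : ε < 1) :
    normalizer F.μ (F.family Θ₀) ε (F.p t) (F.p θ)
      = ∫ x, truncRatio F.μ ε (F.p t) (F.p θ) x ∂F.P s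
        + (upperThreshold F.μ ε (F.p t) (F.p θ) - lowerThreshold F.μ ε (F.p t) (F.p θ)) * ε := by
  have hs : F.P s ∈ F.family Θ₀ := ⟨s, h.1, rfl⟩
  have hle : ∀ P : F.family Θ₀, ∫ x, truncRatio F.μ ε (F.p t) (F.p θ) x ∂(P : Measure 𝒳)
      ≤ ∫ x, truncRatio F.μ ε (F.p t) (F.p θ) x ∂F.P s := by
    rintro ⟨_, u, hu, rfl⟩
    exact integral_truncRatio_le h ht hu hε hε1
  have : Nonempty (F.family Θ₀) := ⟨⟨_, hs⟩⟩
  rw [normalizer]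
  congr 1
  exact le_antisymm (ciSup_le hle)
    (le_ciSup (f := fun P : F.family Θ₀ =>
      ∫ x, truncRatio F.μ ε (F.p t) (F.p θ) x ∂(P : Measure 𝒳))
      ⟨_, Set.forall_mem_range.2 hle⟩ ⟨_, hs⟩)

/-! ### Continuity of the test in the alternative -/

theorem integrable_exp_mul (F : ExpFamily 𝒳) (θ : ℝ) :
    Integrable (fun x => F.h x * Real.exp (θ * F.T x)) F.μ := by
  refine ((F.integrable_dens θ).mul_const (Real.exp (F.A θ))).congr (ae_of_all _ fun x => ?_)
  simp only [dens]
  rw [mul_assoc, ← Real.exp_add, sub_add_cancel]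

/-- For `|θ - θ₁| < 1`, `exp (θ T)` is at most the sum of its values at `θ₁ + 1` and `θ₁ - 1`,
whatever the sign of `T`; continuity gives `A θ > A θ₁ - 1`. -/
theorem exists_dens_bound (hA : Continuous F.A) (θ₁ : ℝ) :
    ∃ b : 𝒳 → ℝ, Integrable b F.μ ∧ ∀ᶠ θ in 𝓝 θ₁, ∀ x, F.dens θ x ≤ b x := by
  refine ⟨fun x => (F.h x * Real.exp ((θ₁ + 1) * F.T x) + F.h x * Real.exp ((θ₁ - 1) * F.T x))
    * Real.exp (1 - F.A θ₁), ((F.integrable_exp_mul _).add (F.integrable_exp_mul _)).mul_const _, ?_⟩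
  filter_upwards [hA.continuousAt.eventually_const_lt (sub_one_lt (F.A θ₁)),
    eventually_gt_nhds (sub_one_lt θ₁), eventually_lt_nhds (lt_add_one θ₁)] with θ h1 h2 h3 x
  rw [← mul_add, mul_assoc]
  refine mul_le_mul_of_nonneg_left ?_ (F.h_nonneg x)
  rw [sub_eq_add_neg, Real.exp_add]
  refine mul_le_mul ?_ (Real.exp_le_exp.2 (by linarith)) (Real.exp_pos _).le (by positivity)
  rcases le_total 0 (F.T x) with hT | hT
  · exact (Real.exp_le_exp.2 (mul_le_mul_of_nonneg_right h3.le hT)).trans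
      (le_add_of_nonneg_right (Real.exp_pos _).le)
  · exact (Real.exp_le_exp.2 (mul_le_mul_of_nonpos_right h2.le hT)).trans
      (le_add_of_nonneg_left (Real.exp_pos _).le)

theorem tendsto_integral_max (hA : Continuous F.A) (θ₁ s a b : ℝ) :
    Tendsto (fun θ => ∫ x, max (a * F.dens θ x) (b * F.dens s x) ∂F.μ) (𝓝 θ₁)
      (𝓝 (∫ x, max (a * F.dens θ₁ x) (b * F.dens s x) ∂F.μ)) := by
  obtain ⟨B, hB, hbound⟩ := exists_dens_bound hA θ₁
  refine tendsto_integral_filter_of_dominated_convergence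
    (fun x => |a| * B x + |b| * F.dens s x) ?_ ?_
    ((hB.const_mul _).add ((F.integrable_dens s).const_mul _)) ?_
  · exact Eventually.of_forall fun θ => (((F.measurable_dens θ).const_mul a).max
      ((F.measurable_dens s).const_mul b)).aestronglyMeasurable
  · filter_upwards [hbound] with θ hθ
    refine ae_of_all _ fun x => ?_
    refine (abs_max_le_max_abs_abs).trans ?_
    rw [abs_mul, abs_mul, abs_of_nonneg (F.dens_nonneg θ x), abs_of_nonneg (F.dens_nonneg s x)]
    refine (max_le_add_of_nonneg (mul_nonneg (abs_nonneg _) (F.dens_nonneg θ x))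
      (mul_nonneg (abs_nonneg _) (F.dens_nonneg s x))).trans ?_
    gcongr
    exact hθ x
  · refine ae_of_all _ fun x => Continuous.tendsto ?_ θ₁
    unfold dens
    fun_prop

theorem tendsto_lowerThreshold (hA : Continuous F.A) (s θ₁ : ℝ) {ε : ℝ} (hε : 0 < ε)
    (hε1 : ε < 1) :
    Tendsto (fun θ => lowerThreshold F.μ ε (F.p s) (F.p θ)) (𝓝 θ₁)
      (𝓝 (lowerThreshold F.μ ε (F.p s) (F.p θ₁))) := by
  refine tendsto_of_maxMass_eq (fs := fun θ => F.dens θ) (gs := fun _ => F.dens s)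
    (F.integrable_dens θ₁) (F.integrable_dens s)
    (F.dens_nonneg θ₁) (F.lower_spec s θ₁ hε hε1).1 (F.lower_spec s θ₁ hε hε1).2 ?_
    F.integrable_dens (fun _ => F.integrable_dens s) (fun _ => F.dens_nonneg s)
    (Eventually.of_forall fun θ => F.lower_spec s θ hε hε1) (F.dens_nonneg s) fun b => ?_
  · rw [F.integral_dens]
    exact (one_lt_inv₀ (by linarith)).2 (by linarith)
  · simpa only [one_mul, maxMass] using tendsto_integral_max hA θ₁ s 1 b

theorem tendsto_upperThreshold (hA : Continuous F.A) (s θ₁ : ℝ) {ε : ℝ} (hε : 0 < ε)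
    (hε1 : ε < 1) :
    Tendsto (fun θ => upperThreshold F.μ ε (F.p s) (F.p θ)) (𝓝 θ₁)
      (𝓝 (upperThreshold F.μ ε (F.p s) (F.p θ₁))) := by
  have hpos := (F.upper_spec s θ₁ hε hε1).1
  have : Tendsto (fun θ => (upperThreshold F.μ ε (F.p s) (F.p θ))⁻¹) (𝓝 θ₁)
      (𝓝 (upperThreshold F.μ ε (F.p s) (F.p θ₁))⁻¹) := by
    refine tendsto_of_maxMass_eq (fs := fun _ => F.dens s) (gs := fun θ => F.dens θ)
      (F.integrable_dens s) (F.integrable_dens θ₁) (F.dens_nonneg s) (inv_pos.2 hpos)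
      (F.upper_spec s θ₁ hε hε1).2 ?_ (fun _ => F.integrable_dens s) F.integrable_dens
      F.dens_nonneg (Eventually.of_forall fun θ => ⟨inv_pos.2 (F.upper_spec s θ hε hε1).1,
        (F.upper_spec s θ hε hε1).2⟩) (F.dens_nonneg θ₁) fun b => ?_
    · rw [F.integral_dens]
      exact (one_lt_inv₀ (by linarith)).2 (by linarith)
    · have := tendsto_integral_max hA θ₁ s b 1
      simpa only [one_mul, max_comm, maxMass] using this
  simpa only [inv_inv] using this.inv₀ (inv_pos.2 hpos).ne'

/-! ### Stability of truncation, and of the bets, under a change of parameter. -/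

theorem abs_clip_sub_clip_le {l u l' u' : ℝ} (y y' : ℝ) :
    |max l (min u y) - max l' (min u' y')| ≤ max |l - l'| (max |u - u'| |y - y'|) :=
  (abs_max_sub_max_le_max _ _ _ _).trans (max_le_max le_rfl (abs_min_sub_min_le_max _ _ _ _))

/-- Truncation to an interval is stable under affine maps close to the identity, uniformly. -/
theorem abs_clip_affine_sub_clip_le {l u ρ κ : ℝ} (hlu : l ≤ u) (hρ : 0 ≤ ρ) (y : ℝ) :
    |max l (min u (ρ * y + κ)) - max l (min u y)| ≤ |ρ - 1| * (|l| + |u|) + |κ| := by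
  set clip : ℝ → ℝ := fun y => max l (min u y) with hclip
  have hmono : Monotone clip := fun a b hab => max_le_max le_rfl (min_le_min le_rfl hab)
  have hmem : ∀ y, l ≤ clip y ∧ clip y ≤ u := fun y =>
    ⟨le_max_left _ _, max_le hlu (min_le_left _ _)⟩
  have hid : ∀ y, l ≤ y → y ≤ u → clip y = y := fun y h1 h2 => by
    simp only [hclip, min_eq_right h2, max_eq_right h1]
  have key : ∀ y, l ≤ y → y ≤ u → |clip (ρ * y + κ) - clip y| ≤ |ρ - 1| * (|l| + |u|) + |κ| := by
    intro y h1 h2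
    have h3 : |clip (ρ * y + κ) - clip y| ≤ |ρ * y + κ - y| := by
      refine (abs_clip_sub_clip_le _ _).trans ?_
      simp
    refine h3.trans ?_
    have h4 : ρ * y + κ - y = (ρ - 1) * y + κ := by ring
    rw [h4]
    refine (abs_add_le _ _).trans ?_
    rw [abs_mul]
    gcongr
    rw [abs_le]
    have := neg_abs_le l
    have := le_abs_self u
    have := abs_nonneg l
    have := abs_nonneg u
    constructor <;> linarith
  change |clip (ρ * y + κ) - clip y| ≤ _
  -- Outside `[l, u]`, monotonicity of the truncation bounds the error by the error at the nearest
  -- endpoint.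
  rcases le_total l y with h1 | h1
  · rcases le_total y u with h2 | h2
    · exact key y h1 h2
    · have e1 : clip y = u := by
        simp only [hclip, min_eq_left h2, max_eq_right hlu]
      have e2 := key u hlu le_rfl
      rw [hid u hlu le_rfl] at e2
      rw [e1]
      refine le_trans ?_ e2
      have h3 : clip (ρ * u + κ) ≤ clip (ρ * y + κ) := hmono (by gcongr)
      rw [abs_sub_comm, abs_sub_comm (clip (ρ * u + κ)), abs_of_nonneg (by linarith [hmem (ρ * y + κ)]),
        abs_of_nonneg (by linarith [hmem (ρ * u + κ)])]
      linarith
  · have e1 : clip y = l := by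
      simp only [hclip, min_eq_right (h1.trans hlu), max_eq_left h1]
    have e2 := key l le_rfl hlu
    rw [hid l le_rfl hlu] at e2
    rw [e1]
    refine le_trans ?_ e2
    have h3 : clip (ρ * y + κ) ≤ clip (ρ * l + κ) := hmono (by gcongr)
    rw [abs_of_nonneg (by linarith [hmem (ρ * y + κ)]),
      abs_of_nonneg (by linarith [hmem (ρ * l + κ)])]
    linarith

theorem max_min_exp {a b : ℝ} (ha : 0 < a) (hb : 0 < b) (y : ℝ) :
    Real.log (max a (min b (Real.exp y))) = max (Real.log a) (min (Real.log b) y) := by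
  rw [← Real.log_exp (max (Real.log a) (min (Real.log b) y)), Real.exp_monotone.map_max,
    Real.exp_monotone.map_min, Real.exp_log ha, Real.exp_log hb]

theorem log_truncRatio_of_ne {ε : ℝ} (hε : 0 < ε) (hε1 : ε < 1) (t θ : ℝ) {x : 𝒳}
    (hx : F.h x ≠ 0) :
    Real.log (truncRatio F.μ ε (F.p t) (F.p θ) x) =
      max (Real.log (lowerThreshold F.μ ε (F.p t) (F.p θ)))
        (min (Real.log (upperThreshold F.μ ε (F.p t) (F.p θ))) (F.logRatio θ t x)) := by
  rw [truncRatio_eq hε hε1, ratio, if_neg hx,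
    max_min_exp (F.lower_spec t θ hε hε1).1 (F.upper_spec t θ hε hε1).1]

theorem log_truncRatio_of_eq {ε : ℝ} (hε : 0 < ε) (hε1 : ε < 1) (t θ : ℝ) {x : 𝒳}
    (hx : F.h x = 0) :
    Real.log (truncRatio F.μ ε (F.p t) (F.p θ) x) =
      Real.log (lowerThreshold F.μ ε (F.p t) (F.p θ)) := by
  rw [truncRatio_eq hε hε1, ratio, if_pos hx, min_eq_right (F.upper_spec t θ hε hε1).1.le,
    max_eq_left (F.lower_spec t θ hε hε1).1.le]

/-- Since `θ₁ ≠ s`, the log ratio at `θ` is an affine function of that at `θ₁`, with slope `ρ → 1`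
and intercept `κ → 0`. Truncation makes the closeness uniform although `T` may be unbounded. Points
with `h = 0` are covered too, since a contaminated `Q` may charge them. -/
theorem eventually_abs_log_truncRatio_sub_le (hA : Continuous F.A) {s θ₁ : ℝ} (hne : θ₁ ≠ s)
    {ε : ℝ} (hε : 0 < ε) (hε1 : ε < 1)
    (hlu : lowerThreshold F.μ ε (F.p s) (F.p θ₁) < upperThreshold F.μ ε (F.p s) (F.p θ₁))
    {η : ℝ} (hη : 0 < η) :
    ∀ᶠ θ in 𝓝 θ₁, ∀ x, |Real.log (truncRatio F.μ ε (F.p s) (F.p θ) x)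
      - Real.log (truncRatio F.μ ε (F.p s) (F.p θ₁) x)| ≤ η := by
  set l : ℝ → ℝ := fun θ => Real.log (lowerThreshold F.μ ε (F.p s) (F.p θ)) with hl
  set u : ℝ → ℝ := fun θ => Real.log (upperThreshold F.μ ε (F.p s) (F.p θ)) with hu
  have hl1 : Tendsto l (𝓝 θ₁) (𝓝 (l θ₁)) :=
    (tendsto_lowerThreshold hA s θ₁ hε hε1).log (F.lower_spec s θ₁ hε hε1).1.ne'
  have hu1 : Tendsto u (𝓝 θ₁) (𝓝 (u θ₁)) :=
    (tendsto_upperThreshold hA s θ₁ hε hε1).log (F.upper_spec s θ₁ hε hε1).1.ne'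
  have hlu1 : l θ₁ ≤ u θ₁ := Real.log_le_log (F.lower_spec s θ₁ hε hε1).1 hlu.le
  set ρ : ℝ → ℝ := fun θ => (θ - s) / (θ₁ - s) with hρ
  set κ : ℝ → ℝ := fun θ => (F.A s - F.A θ) - ρ θ * (F.A s - F.A θ₁) with hκ
  have hne' : θ₁ - s ≠ 0 := sub_ne_zero.2 hne
  have hρc : Continuous ρ := by fun_prop
  have hρ1 : ρ θ₁ = 1 := div_self hne'
  set δ : ℝ → ℝ := fun θ => |l θ - l θ₁| + |u θ - u θ₁| +
    (|ρ θ - 1| * (|l θ₁| + |u θ₁|) + |κ θ|) with hδ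
  have hδ0 : Tendsto δ (𝓝 θ₁) (𝓝 0) := by
    have h1 : Tendsto (fun θ => |l θ - l θ₁|) (𝓝 θ₁) (𝓝 0) := by
      simpa using (hl1.sub_const (l θ₁)).abs
    have h2 : Tendsto (fun θ => |u θ - u θ₁|) (𝓝 θ₁) (𝓝 0) := by
      simpa using (hu1.sub_const (u θ₁)).abs
    have h3 : Tendsto (fun θ => |ρ θ - 1| * (|l θ₁| + |u θ₁|) + |κ θ|) (𝓝 θ₁) (𝓝 0) := by
      have hc : Continuous fun θ => |ρ θ - 1| * (|l θ₁| + |u θ₁|) + |κ θ| := by fun_prop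
      have := hc.tendsto θ₁
      simpa [hρ1, hκ] using this
    simpa using (h1.add h2).add h3
  have hρ0 : ∀ᶠ θ in 𝓝 θ₁, 0 < ρ θ := by
    have := hρc.tendsto θ₁
    rw [hρ1] at this
    exact this.eventually_const_lt one_pos
  filter_upwards [hδ0.eventually_le_const hη, hρ0] with θ h1 h2 x
  refine le_trans ?_ h1
  by_cases hx : F.h x = 0
  · rw [log_truncRatio_of_eq hε hε1 _ _ hx, log_truncRatio_of_eq hε hε1 _ _ hx]
    have : 0 ≤ |ρ θ - 1| * (|l θ₁| + |u θ₁|) + |κ θ| := by positivity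
    have := abs_nonneg (u θ - u θ₁)
    change |l θ - l θ₁| ≤ δ θ
    simp only [hδ]
    linarith
  · rw [log_truncRatio_of_ne hε hε1 _ _ hx, log_truncRatio_of_ne hε hε1 _ _ hx]
    have e : F.logRatio θ s x = ρ θ * F.logRatio θ₁ s x + κ θ := by
      simp only [logRatio, hκ, hρ]
      field_simp
      ring
    change |max (l θ) (min (u θ) _) - max (l θ₁) (min (u θ₁) _)| ≤ δ θ
    rw [e]
    refine (abs_sub_le _ (max (l θ₁) (min (u θ₁) (ρ θ * F.logRatio θ₁ s x + κ θ))) _).trans ?_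
    refine add_le_add ((abs_clip_sub_clip_le _ _).trans ?_)
      (abs_clip_affine_sub_clip_le hlu1 h2.le _)
    rw [sub_self, abs_zero, max_eq_left (abs_nonneg (u θ - u θ₁))]
    exact max_le_add_of_nonneg (abs_nonneg _) (abs_nonneg _)

theorem tendsto_integral_truncRatio (hA : Continuous F.A) {s θ₁ : ℝ} (hne : θ₁ ≠ s)
    {ε : ℝ} (hε : 0 < ε) (hε1 : ε < 1)
    (hlu : lowerThreshold F.μ ε (F.p s) (F.p θ₁) < upperThreshold F.μ ε (F.p s) (F.p θ₁)) :
    Tendsto (fun θ => ∫ x, truncRatio F.μ ε (F.p s) (F.p θ) x ∂F.P s) (𝓝 θ₁)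
      (𝓝 (∫ x, truncRatio F.μ ε (F.p s) (F.p θ₁) x ∂F.P s)) := by
  have hl := tendsto_lowerThreshold hA s θ₁ hε hε1
  have hu := tendsto_upperThreshold hA s θ₁ hε hε1
  refine tendsto_integral_filter_of_dominated_convergence
    (fun _ => max (lowerThreshold F.μ ε (F.p s) (F.p θ₁))
      (upperThreshold F.μ ε (F.p s) (F.p θ₁)) + 1)
    (Eventually.of_forall fun θ => (measurable_truncRatio_p ε s θ).aestronglyMeasurable) ?_
    (integrable_const _) (ae_of_all _ fun x => ?_)
  · filter_upwards [(hl.max hu).eventually_le_const (lt_add_one _)] with θ hθ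
    refine ae_of_all _ fun x => ?_
    rw [Real.norm_of_nonneg ((F.lower_spec s θ hε hε1).1.le.trans
      (lower_le_truncRatio hε hε1 s θ x))]
    exact (truncRatio_le hε hε1 s θ x).trans hθ
  · have hlog : Tendsto (fun θ => Real.log (truncRatio F.μ ε (F.p s) (F.p θ) x)) (𝓝 θ₁)
        (𝓝 (Real.log (truncRatio F.μ ε (F.p s) (F.p θ₁) x))) := by
      refine Metric.tendsto_nhds.2 fun η hη => ?_
      filter_upwards [eventually_abs_log_truncRatio_sub_le hA hne hε hε1 hlu (half_pos hη)]
        with θ hθ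
      rw [Real.dist_eq]
      exact (hθ x).trans_lt (half_lt_self hη)
    have := hlog.rexp
    simp_rw [Real.exp_log (truncRatio_pos (F.lower_spec s _ hε hε1).1 x)] at this
    exact this

/-- Near `θ₁` the same `s` still separates, so the projection density stays `p_s`, and the
thresholds stay strictly ordered, so the plug-in factor is the genuine bet. -/
theorem eventually_abs_log_plugInBet_sub_le (hconv : ConvexOn ℝ Set.univ F.A)
    (hA : Continuous F.A) {Θ₀ : Set ℝ} {s θ₁ : ℝ} (h : Separates Θ₀ s θ₁)
    {ε : ℝ} (hε : 0 < ε) (hε1 : ε < 1) (hlu : F.cLower Θ₀ ε θ₁ < F.cUpper Θ₀ ε θ₁)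
    {η : ℝ} (hη : 0 < η) :
    ∀ᶠ θ in 𝓝 θ₁, ∀ x,
      |Real.log (plugInBet F.μ (F.family Θ₀) ε (F.riprDensity Θ₀ θ) (F.p θ) x)
        - Real.log (bet F.μ (F.family Θ₀) ε (F.riprDensity Θ₀ θ₁) (F.p θ₁) x)| ≤ η := by
  have hd : ∀ {θ}, Separates Θ₀ s θ → F.riprDensity Θ₀ θ = F.p s := fun h' =>
    riprDensity_eq hconv h hε hε1 hlu h'
  have hlu' : lowerThreshold F.μ ε (F.p s) (F.p θ₁) < upperThreshold F.μ ε (F.p s) (F.p θ₁) := by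
    rwa [cLower, cUpper, hd h] at hlu
  have hl := tendsto_lowerThreshold hA s θ₁ hε hε1
  have hu := tendsto_upperThreshold hA s θ₁ hε hε1
  have hN : Tendsto (fun θ => Real.log (normalizer F.μ (F.family Θ₀) ε (F.p s) (F.p θ))) (𝓝 θ₁)
      (𝓝 (Real.log (normalizer F.μ (F.family Θ₀) ε (F.p s) (F.p θ₁)))) := by
    refine Tendsto.log ?_ (normalizer_pos hε hlu').ne'
    rw [normalizer_eq h h.1 hε hε1]
    refine ((tendsto_integral_truncRatio hA h.2.1 hε hε1 hlu').add
      ((hu.sub hl).mul_const ε)).congr' ?_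
    filter_upwards [h.eventually] with θ hθ
    rw [normalizer_eq hθ hθ.1 hε hε1]
  filter_upwards [h.eventually, hl.eventually_lt hu hlu',
    eventually_abs_log_truncRatio_sub_le hA h.2.1 hε hε1 hlu' (half_pos hη),
    Metric.tendsto_nhds.1 hN _ (half_pos hη)] with θ h1 h2 h3 h4 x
  rw [hd h, hd h1, plugInBet, if_pos h2, bet, bet,
    Real.log_div (truncRatio_pos (F.lower_spec s θ hε hε1).1 x).ne' (normalizer_pos hε h2).ne',
    Real.log_div (truncRatio_pos (F.lower_spec s θ₁ hε hε1).1 x).ne' (normalizer_pos hε hlu').ne']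
  rw [Real.dist_eq, abs_lt] at h4
  have h5 := abs_le.1 (h3 x)
  rw [abs_le]
  constructor <;> linarith [h4.1, h4.2, h5.1, h5.2]

end ExpFamily

/-! ### Integrals of bounded functions over neighbourhoods -/

/-- Layer-cake formula: the superlevel sets of `f - a` contribute at most `ε` for each level in `(0,
b - a]`. -/
theorem integral_sub_integral_le {P Q : Measure 𝒳} [IsProbabilityMeasure P]
    [IsProbabilityMeasure Q] {f : 𝒳 → ℝ} (hf : Measurable f) {a b ε : ℝ} (hab : a ≤ b)
    (hfa : ∀ x, a ≤ f x) (hfb : ∀ x, f x ≤ b)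
    (hPQ : ∀ S, MeasurableSet S → P.real S - Q.real S ≤ ε) :
    ∫ x, f x ∂P - ∫ x, f x ∂Q ≤ (b - a) * ε := by
  have hg : Measurable fun x => f x - a := hf.sub_const a
  have hint : ∀ (ρ : Measure 𝒳) [IsProbabilityMeasure ρ], Integrable f ρ := fun ρ _ =>
    Integrable.of_bound hf.aestronglyMeasurable (max |a| |b|) (ae_of_all _ fun x =>
      abs_le_max_abs_abs (hfa x) (hfb x))
  have hlayer : ∀ (ρ : Measure 𝒳) [IsProbabilityMeasure ρ],
      (∫ x, f x ∂ρ) - a = ∫ t in Set.Ioc 0 (b - a), ρ.real {x | t ≤ f x - a} := by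
    intro ρ _
    have := Integrable.integral_eq_integral_Ioc_meas_le (M := b - a)
      ((hint ρ).sub (integrable_const a)) (ae_of_all _ fun x => sub_nonneg.2 (hfa x))
      (ae_of_all _ fun x => sub_le_sub_right (hfb x) a)
    simp only [Pi.sub_apply] at this
    rw [← this, integral_sub (hint ρ) (integrable_const a)]
    simp
  have hon : ∀ (ρ : Measure 𝒳) [IsProbabilityMeasure ρ],
      IntegrableOn (fun t => ρ.real {x | t ≤ f x - a}) (Set.Ioc 0 (b - a)) := by
    intro ρ _
    have hanti : Antitone fun t => ρ.real {x | t ≤ f x - a} := fun s t hst =>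
      measureReal_mono fun x hx => hst.trans hx
    refine Integrable.of_bound hanti.measurable.aestronglyMeasurable 1 (ae_of_all _ fun t => ?_)
    rw [Real.norm_of_nonneg measureReal_nonneg]
    exact measureReal_le_one
  have hsub : ∫ x, f x ∂P - ∫ x, f x ∂Q = ∫ t in Set.Ioc 0 (b - a),
      (P.real {x | t ≤ f x - a} - Q.real {x | t ≤ f x - a}) := by
    rw [integral_sub (hon P) (hon Q), ← hlayer P, ← hlayer Q]
    ring
  rw [hsub]
  calc _ ≤ ∫ _ in Set.Ioc 0 (b - a), ε :=
        integral_mono ((hon P).sub (hon Q)) (integrable_const ε) fun t =>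
          hPQ _ (measurableSet_le measurable_const hg)
    _ = (b - a) * ε := by simp [hab]

/-- Measures in either neighbourhood are `ε`-close in total variation. -/
theorem abs_real_sub_real_le_of_mem {P Q : Measure 𝒳} [IsProbabilityMeasure P] {ε : ℝ} (hε : 0 < ε)
    (hε1 : ε < 1) (hQ : Q ∈ contaminationBall ε P ∨ Q ∈ tvBall ε P) :
    IsProbabilityMeasure Q ∧ ∀ S, MeasurableSet S → |P.real S - Q.real S| ≤ ε := by
  rcases hQ with ⟨hQ, H, hH, rfl⟩ | ⟨hQ, htv⟩
  · refine ⟨hQ, fun S _ => ?_⟩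
    have e : (ENNReal.ofReal (1 - ε) • P + ENNReal.ofReal ε • H).real S
        = (1 - ε) * P.real S + ε * H.real S := by
      simp only [Measure.real, Measure.add_apply, Measure.smul_apply, smul_eq_mul]
      rw [ENNReal.toReal_add (by finiteness) (by finiteness), ENNReal.toReal_mul,
        ENNReal.toReal_mul, ENNReal.toReal_ofReal hε.le, ENNReal.toReal_ofReal (by linarith)]
    have h1 : P.real S ≤ 1 := measureReal_le_one
    have h2 : H.real S ≤ 1 := measureReal_le_one
    have h3 : 0 ≤ P.real S := measureReal_nonneg
    have h4 : 0 ≤ H.real S := measureReal_nonneg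
    rw [e, abs_le]
    constructor <;> nlinarith
  · refine ⟨hQ, fun S hS => le_trans ?_ htv⟩
    refine le_ciSup (f := fun S : {S : Set 𝒳 // MeasurableSet S} => |P.real S.1 - Q.real S.1|)
      ⟨1, ?_⟩ ⟨S, hS⟩
    rintro _ ⟨S, rfl⟩
    have h1 : P.real S.1 ≤ 1 := measureReal_le_one
    have h2 : Q.real S.1 ≤ 1 := measureReal_le_one
    have h3 : 0 ≤ P.real S.1 := measureReal_nonneg
    have h4 : 0 ≤ Q.real S.1 := measureReal_nonneg
    exact abs_le.2 ⟨by linarith, by linarith⟩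

namespace ExpFamily

variable {F : ExpFamily 𝒳}

/-! ### Almost sure growth rates -/

theorem log_truncRatio_mem {ε : ℝ} (hε : 0 < ε) (hε1 : ε < 1) (t θ : ℝ) (x : 𝒳) :
    Real.log (lowerThreshold F.μ ε (F.p t) (F.p θ))
        ≤ Real.log (truncRatio F.μ ε (F.p t) (F.p θ) x) ∧
      Real.log (truncRatio F.μ ε (F.p t) (F.p θ) x)
        ≤ max (Real.log (lowerThreshold F.μ ε (F.p t) (F.p θ)))
          (Real.log (upperThreshold F.μ ε (F.p t) (F.p θ))) := by
  by_cases hx : F.h x = 0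
  · rw [log_truncRatio_of_eq hε hε1 _ _ hx]
    exact ⟨le_rfl, le_max_left _ _⟩
  · rw [log_truncRatio_of_ne hε hε1 _ _ hx]
    exact ⟨le_max_left _ _, max_le_max le_rfl (min_le_left _ _)⟩

theorem measurable_log_truncRatio (ε t θ : ℝ) :
    Measurable fun x => Real.log (truncRatio F.μ ε (F.p t) (F.p θ) x) :=
  (measurable_truncRatio_p ε t θ).log

theorem integrable_log_truncRatio {ε : ℝ} (hε : 0 < ε) (hε1 : ε < 1) (t θ : ℝ) (Q : Measure 𝒳)
    [IsFiniteMeasure Q] :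
    Integrable (fun x => Real.log (truncRatio F.μ ε (F.p t) (F.p θ) x)) Q :=
  Integrable.of_bound (measurable_log_truncRatio ε t θ).aestronglyMeasurable _
    (ae_of_all _ fun x => abs_le_max_abs_abs (log_truncRatio_mem hε hε1 t θ x).1
      (log_truncRatio_mem hε hε1 t θ x).2)

/-- Needed for every `θ`: early estimates need not be near `θ₁`, yet the logarithm of the product
splits only if all factors are nonzero. -/
theorem plugInBet_pos {Θ₀ : Set ℝ} (hne : Θ₀.Nonempty) {ε : ℝ} (hε : 0 < ε) (hε1 : ε < 1)
    (θ : ℝ) (x : 𝒳) : 0 < plugInBet F.μ (F.family Θ₀) ε (F.riprDensity Θ₀ θ) (F.p θ) x := by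
  rw [plugInBet]
  split_ifs with h
  · exact bet_pos hε (cLower_pos hne θ hε hε1) h x
  · exact one_pos

variable {Ω : Type*} [MeasurableSpace Ω] {ν : Measure Ω}
  {X : ℕ → Ω → 𝒳} {Q : Measure 𝒳}

theorem tendsto_average_log_bet {Θ₀ : Set ℝ} {θ t : ℝ} (hd : F.riprDensity Θ₀ θ = F.p t)
    {ε : ℝ} (hε : 0 < ε) (hε1 : ε < 1) (hlu : F.cLower Θ₀ ε θ < F.cUpper Θ₀ ε θ)
    [IsProbabilityMeasure Q] (hX : ∀ i, Measurable (X i)) (hind : iIndepFun X ν)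
    (hmap : ∀ i, ν.map (X i) = Q) :
    ∀ᵐ ω ∂ν, Tendsto (fun n : ℕ => (∑ i ∈ Finset.range n,
      Real.log (bet F.μ (F.family Θ₀) ε (F.riprDensity Θ₀ θ) (F.p θ) (X i ω))) / n) atTop
      (𝓝 (F.rate Θ₀ ε θ Q)) := by
  rw [cLower, cUpper, hd] at hlu
  rw [rate, growthRate, hd]
  set N := normalizer F.μ (F.family Θ₀) ε (F.p t) (F.p θ)
  set f : 𝒳 → ℝ := fun x => Real.log (bet F.μ (F.family Θ₀) ε (F.p t) (F.p θ) x) with hf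
  have hfe : f = fun x => Real.log (truncRatio F.μ ε (F.p t) (F.p θ) x) - Real.log N := by
    ext x
    simp only [hf, bet]
    exact Real.log_div (truncRatio_pos (F.lower_spec t θ hε hε1).1 x).ne' (normalizer_pos hε hlu).ne'
  have hfm : Measurable f := by
    rw [hfe]
    exact (measurable_log_truncRatio ε t θ).sub_const _
  have hfi : Integrable f Q := by
    rw [hfe]
    exact (integrable_log_truncRatio hε hε1 t θ Q).sub (integrable_const _)
  have hmean : ∫ ω, f (X 0 ω) ∂ν
      = ∫ x, Real.log (truncRatio F.μ ε (F.p t) (F.p θ) x) ∂Q - Real.log N := by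
    rw [← integral_map (hX 0).aemeasurable hfm.aestronglyMeasurable, hmap, hfe,
      integral_sub (integrable_log_truncRatio hε hε1 t θ Q) (integrable_const _)]
    simp
  rw [← hmean]
  refine strong_law_ae_real (fun i ω => f (X i ω)) ?_ ?_ ?_
  · have : Integrable f (ν.map (X 0)) := by rwa [hmap]
    exact this.comp_measurable (hX 0)
  · intro i j hij
    exact (hind.indepFun hij).comp hfm hfm
  · intro i
    have : IdentDistrib (X i) (X 0) ν ν :=
      ⟨(hX i).aemeasurable, (hX 0).aemeasurable, by rw [hmap, hmap]⟩
    exact this.comp hfm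

theorem tendsto_log_riprWealth {Θ₀ : Set ℝ} (hne : Θ₀.Nonempty) {θ t : ℝ}
    (hd : F.riprDensity Θ₀ θ = F.p t)
    {ε : ℝ} (hε : 0 < ε) (hε1 : ε < 1) (hlu : F.cLower Θ₀ ε θ < F.cUpper Θ₀ ε θ)
    [IsProbabilityMeasure Q] (hX : ∀ i, Measurable (X i)) (hind : iIndepFun X ν)
    (hmap : ∀ i, ν.map (X i) = Q) :
    ∀ᵐ ω ∂ν, Tendsto (fun n : ℕ => (1 / (n : ℝ)) *
      Real.log (F.riprWealth Θ₀ ε θ (fun i => X i ω) n)) atTop (𝓝 (F.rate Θ₀ ε θ Q)) := by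
  filter_upwards [tendsto_average_log_bet hd hε hε1 hlu hX hind hmap] with ω hω
  refine hω.congr fun n => ?_
  rw [riprWealth, Real.log_prod fun i _ => (bet_pos hε (cLower_pos hne θ hε hε1) hlu _).ne',
    one_div, div_eq_inv_mul]

theorem tendsto_log_plugInWealth (hconv : ConvexOn ℝ Set.univ F.A) (hA : Continuous F.A)
    {Θ₀ : Set ℝ} {s θ₁ : ℝ} (h : Separates Θ₀ s θ₁)
    {ε : ℝ} (hε : 0 < ε) (hε1 : ε < 1) (hlu : F.cLower Θ₀ ε θ₁ < F.cUpper Θ₀ ε θ₁)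
    [IsProbabilityMeasure Q] (hX : ∀ i, Measurable (X i)) (hind : iIndepFun X ν)
    (hmap : ∀ i, ν.map (X i) = Q) {θhat : (i : ℕ) → (Fin i → 𝒳) → ℝ}
    (hθ : ∀ᵐ ω ∂ν, Tendsto (fun n => θhat n (fun j => X j ω)) atTop (𝓝 θ₁)) :
    ∀ᵐ ω ∂ν, Tendsto (fun n : ℕ => (1 / (n : ℝ)) *
      Real.log (F.plugInWealth Θ₀ ε θhat (fun i => X i ω) n)) atTop (𝓝 (F.rate Θ₀ ε θ₁ Q)) := by
  have hd := riprDensity_eq hconv h hε hε1 hlu h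
  filter_upwards [tendsto_average_log_bet hd hε hε1 hlu hX hind hmap, hθ] with ω hω hθω
  set b : ℕ → ℝ := fun i => Real.log (plugInBet F.μ (F.family Θ₀) ε
    (F.riprDensity Θ₀ (θhat i fun j => X j ω)) (F.p (θhat i fun j => X j ω)) (X i ω)) with hb
  set f : ℕ → ℝ := fun i =>
    Real.log (bet F.μ (F.family Θ₀) ε (F.riprDensity Θ₀ θ₁) (F.p θ₁) (X i ω)) with hf
  -- Closeness is uniform in `x`, so it may be evaluated at `X i`, with no argument about how the
  -- estimate depends on the data.
  have hdiff : Tendsto (fun i => b i - f i) atTop (𝓝 0) := by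
    refine Metric.tendsto_nhds.2 fun η hη => ?_
    filter_upwards [hθω.eventually
      (eventually_abs_log_plugInBet_sub_le hconv hA h hε hε1 hlu (half_pos hη))] with i hi
    rw [Real.dist_eq, sub_zero]
    exact (hi (X i ω)).trans_lt (half_lt_self hη)
  have hsum := hdiff.cesaro.add hω
  rw [zero_add] at hsum
  refine hsum.congr fun n => ?_
  rw [plugInWealth, Real.log_prod fun i _ => (plugInBet_pos ⟨s, h.1⟩ hε hε1 _ _).ne']
  rw [Finset.sum_sub_distrib, one_div, div_eq_inv_mul, ← mul_add, sub_add_cancel]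

/-! ### The least favourable pair -/

/-- As a maximum, the density has the total mass that the threshold equation sets to one. -/
theorem q₀_eq {ε : ℝ} (hε : 0 < ε) (hε1 : ε < 1) (t θ : ℝ) (x : 𝒳) :
    q₀ F.μ ε (F.p t) (F.p θ) x = ENNReal.ofReal ((1 - ε) *
      max (F.dens t x) ((upperThreshold F.μ ε (F.p t) (F.p θ))⁻¹ * F.dens θ x)) := by
  have hu := (F.upper_spec t θ hε hε1).1
  set u := upperThreshold F.μ ε (F.p t) (F.p θ)
  have he : 0 ≤ 1 - ε := by linarith
  rw [q₀]
  split_ifs with h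
  · have h1 := toReal_le_mul_of_div_le hu (F.p_ne_top t x) h.le
    rw [toReal_p, toReal_p] at h1
    rw [max_eq_left ((inv_mul_le_iff₀ hu).2 h1), ENNReal.ofReal_mul he, ← p_eq_ofReal]
  · have h1 := mul_toReal_le_of_le_div hu (F.p_ne_top t x) (not_lt.1 h) (F.p_ne_top θ x)
    rw [toReal_p, toReal_p] at h1
    rw [max_eq_right ((le_inv_mul_iff₀ hu).2 h1), ENNReal.ofReal_mul he,
      ENNReal.ofReal_mul (inv_pos.2 hu).le, ← p_eq_ofReal, ENNReal.ofReal_inv_of_pos hu,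
      mul_left_comm]

theorem q₁_eq {ε : ℝ} (hε : 0 < ε) (hε1 : ε < 1) (t θ : ℝ) (x : 𝒳) :
    q₁ F.μ ε (F.p t) (F.p θ) x = ENNReal.ofReal ((1 - ε) *
      max (F.dens θ x) (lowerThreshold F.μ ε (F.p t) (F.p θ) * F.dens t x)) := by
  have hl := (F.lower_spec t θ hε hε1).1
  set l := lowerThreshold F.μ ε (F.p t) (F.p θ)
  have he : 0 ≤ 1 - ε := by linarith
  rw [q₁]
  split_ifs with h
  · have h1 := mul_toReal_le_of_le_div hl (F.p_ne_top t x) h.le (F.p_ne_top θ x)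
    rw [toReal_p, toReal_p] at h1
    rw [max_eq_left h1, ENNReal.ofReal_mul he, ← p_eq_ofReal]
  · have h1 := toReal_le_mul_of_div_le hl (F.p_ne_top t x) (not_lt.1 h)
    rw [toReal_p, toReal_p] at h1
    rw [max_eq_right h1, ENNReal.ofReal_mul he, ENNReal.ofReal_mul hl.le, ← p_eq_ofReal,
      mul_left_comm]

theorem isProbabilityMeasure_of_maxMass {ε : ℝ} (hε1 : ε < 1) {f g : 𝒳 → ℝ} {c : ℝ}
    {μ : Measure 𝒳} (hf : Integrable f μ) (hg : Integrable g μ) (hf0 : ∀ x, 0 ≤ f x)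
    (h : maxMass μ f g c = (1 - ε)⁻¹) :
    IsProbabilityMeasure (μ.withDensity fun x => ENNReal.ofReal ((1 - ε) * max (f x) (c * g x))) := by
  have he : 0 < 1 - ε := by linarith
  refine ⟨?_⟩
  rw [withDensity_apply _ MeasurableSet.univ, setLIntegral_univ,
    ← ofReal_integral_eq_lintegral_ofReal ((integrable_max_mul hf hg c).const_mul _)
      (ae_of_all _ fun x => mul_nonneg he.le (le_max_of_le_left (hf0 x))), integral_const_mul]
  rw [maxMass] at h
  rw [h, mul_inv_cancel₀ he.ne', ENNReal.ofReal_one]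

theorem isProbabilityMeasure_Q₀ {ε : ℝ} (hε : 0 < ε) (hε1 : ε < 1) (t θ : ℝ) :
    IsProbabilityMeasure (RobustRIPr.Q₀ F.μ ε (F.p t) (F.p θ)) := by
  rw [RobustRIPr.Q₀, funext (q₀_eq (F := F) hε hε1 t θ)]
  exact isProbabilityMeasure_of_maxMass hε1 (F.integrable_dens t) (F.integrable_dens θ)
    (F.dens_nonneg t) (F.upper_spec t θ hε hε1).2

theorem isProbabilityMeasure_Q₁ {ε : ℝ} (hε : 0 < ε) (hε1 : ε < 1) (t θ : ℝ) :
    IsProbabilityMeasure (RobustRIPr.Q₁ F.μ ε (F.p t) (F.p θ)) := by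
  rw [RobustRIPr.Q₁, funext (q₁_eq (F := F) hε hε1 t θ)]
  exact isProbabilityMeasure_of_maxMass hε1 (F.integrable_dens θ) (F.integrable_dens t)
    (F.dens_nonneg θ) (F.lower_spec t θ hε hε1).2

/-- `Q₁` dominates `(1 - ε) P_θ`; applying this to `S` and to its complement gives the two signs. -/
theorem P_real_sub_Q₁_real_le {ε : ℝ} (hε : 0 < ε) (hε1 : ε < 1) (t θ : ℝ) {S : Set 𝒳}
    (hS : MeasurableSet S) :
    |(F.P θ).real S - (RobustRIPr.Q₁ F.μ ε (F.p t) (F.p θ)).real S| ≤ ε := by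
  have := isProbabilityMeasure_Q₁ (F := F) hε hε1 t θ
  set R := RobustRIPr.Q₁ F.μ ε (F.p t) (F.p θ) with hR
  have he : 0 ≤ 1 - ε := by linarith
  have hle : ENNReal.ofReal (1 - ε) • F.P θ ≤ R := by
    rw [hR, RobustRIPr.Q₁, P, ← withDensity_smul _ (F.measurable_p θ)]
    refine withDensity_mono (ae_of_all _ fun x => ?_)
    rw [q₁_eq hε hε1, Pi.smul_apply, smul_eq_mul, p_eq_ofReal, ← ENNReal.ofReal_mul he]
    exact ENNReal.ofReal_le_ofReal (mul_le_mul_of_nonneg_left (le_max_left _ _) he)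
  have hle' : ∀ S, (1 - ε) * (F.P θ).real S ≤ R.real S := by
    intro S
    have h1 := ENNReal.toReal_mono (measure_ne_top R S) (hle S)
    rwa [Measure.smul_apply, smul_eq_mul, ENNReal.toReal_mul, ENNReal.toReal_ofReal he] at h1
  have h1 := hle' S
  have h2 := hle' Sᶜ
  rw [probReal_compl_eq_one_sub hS, probReal_compl_eq_one_sub hS] at h2
  have h3 : (F.P θ).real S ≤ 1 := measureReal_le_one
  have h4 : 0 ≤ (F.P θ).real S := measureReal_nonneg
  rw [abs_le]
  constructor <;> nlinarith

theorem Q₁_eq_withDensity {ε : ℝ} (hε : 0 < ε) (hε1 : ε < 1) (t θ : ℝ)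
    (hlu : lowerThreshold F.μ ε (F.p t) (F.p θ) < upperThreshold F.μ ε (F.p t) (F.p θ)) :
    RobustRIPr.Q₁ F.μ ε (F.p t) (F.p θ) = (RobustRIPr.Q₀ F.μ ε (F.p t) (F.p θ)).withDensity
      fun x => ENNReal.ofReal (truncRatio F.μ ε (F.p t) (F.p θ) x) := by
  have he : 0 ≤ 1 - ε := by linarith
  have hl := (F.lower_spec t θ hε hε1).1
  have hu := (F.upper_spec t θ hε hε1).1
  have hm : Measurable (q₀ F.μ ε (F.p t) (F.p θ)) := by
    rw [funext (q₀_eq (F := F) hε hε1 t θ)]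
    exact (((F.measurable_dens t).max ((F.measurable_dens θ).const_mul _)).const_mul _).ennreal_ofReal
  rw [RobustRIPr.Q₁, RobustRIPr.Q₀,
    ← withDensity_mul _ hm (measurable_truncRatio_p ε t θ).ennreal_ofReal]
  congr 1
  ext x
  rw [Pi.mul_apply, q₀_eq hε hε1, q₁_eq hε hε1, ← ENNReal.ofReal_mul
    (mul_nonneg he (le_max_of_le_left (F.dens_nonneg t x))), truncRatio_eq hε hε1, mul_assoc]
  congr 2
  set l := lowerThreshold F.μ ε (F.p t) (F.p θ)
  set u := upperThreshold F.μ ε (F.p t) (F.p θ)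
  by_cases hx : F.h x = 0
  · simp [dens, hx]
  rw [ratio, if_neg hx, F.dens_eq_mul_exp θ t]
  have hd := F.dens_nonneg t x
  set r := Real.exp (F.logRatio θ t x)
  have e1 : max (F.dens t x * r) (l * F.dens t x) = F.dens t x * max r l := by
    rw [mul_max_of_nonneg _ _ hd, mul_comm l]
  have e2 : max (F.dens t x) (u⁻¹ * (F.dens t x * r)) = F.dens t x * max 1 (u⁻¹ * r) := by
    rw [mul_max_of_nonneg _ _ hd, mul_one, mul_left_comm]
  rw [e1, e2, mul_assoc]
  congr 1
  rcases le_total r u with h | h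
  · rw [min_eq_right h, max_eq_left ((inv_mul_le_iff₀ hu).2 (by linarith)), one_mul, max_comm]
  · rw [min_eq_left h, max_eq_right hlu.le, max_eq_left (hlu.le.trans h),
      max_eq_right ((le_inv_mul_iff₀ hu).2 (by linarith))]
    field_simp

theorem klDiv_withDensity {R : Measure 𝒳} [IsProbabilityMeasure R] {f : 𝒳 → ℝ}
    (hf : Measurable f) (hf0 : ∀ x, 0 ≤ f x)
    [IsProbabilityMeasure (R.withDensity fun x => ENNReal.ofReal (f x))]
    (hint : Integrable (fun x => Real.log (f x)) (R.withDensity fun x => ENNReal.ofReal (f x))) :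
    InformationTheory.klDiv (R.withDensity fun x => ENNReal.ofReal (f x)) R ≠ ∞ ∧
      (InformationTheory.klDiv (R.withDensity fun x => ENNReal.ofReal (f x)) R).toReal
        = ∫ x, Real.log (f x) ∂(R.withDensity fun x => ENNReal.ofReal (f x)) := by
  set R' := R.withDensity fun x => ENNReal.ofReal (f x)
  have hac : R' ≪ R := withDensity_absolutelyContinuous _ _
  have hllr : llr R' R =ᵐ[R'] fun x => Real.log (f x) := by
    filter_upwards [hac.ae_le (Measure.rnDeriv_withDensity R hf.ennreal_ofReal)] with x hx
    rw [llr_def]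
    simp only
    rw [hx, ENNReal.toReal_ofReal (hf0 x)]
  refine ⟨InformationTheory.klDiv_ne_top hac (hint.congr hllr.symm), ?_⟩
  rw [InformationTheory.toReal_klDiv_of_measure_eq hac (by rw [measure_univ, measure_univ]),
    integral_congr_ae hllr]

theorem klDiv_Q₁_Q₀ {ε : ℝ} (hε : 0 < ε) (hε1 : ε < 1) (t θ : ℝ)
    (hlu : lowerThreshold F.μ ε (F.p t) (F.p θ) < upperThreshold F.μ ε (F.p t) (F.p θ)) :
    InformationTheory.klDiv (RobustRIPr.Q₁ F.μ ε (F.p t) (F.p θ))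
        (RobustRIPr.Q₀ F.μ ε (F.p t) (F.p θ)) ≠ ∞ ∧
      (InformationTheory.klDiv (RobustRIPr.Q₁ F.μ ε (F.p t) (F.p θ))
        (RobustRIPr.Q₀ F.μ ε (F.p t) (F.p θ))).toReal
        = ∫ x, Real.log (truncRatio F.μ ε (F.p t) (F.p θ) x)
          ∂(RobustRIPr.Q₁ F.μ ε (F.p t) (F.p θ)) := by
  have h0 := isProbabilityMeasure_Q₀ (F := F) hε hε1 t θ
  have h1 := isProbabilityMeasure_Q₁ (F := F) hε hε1 t θ
  have hint := integrable_log_truncRatio (F := F) hε hε1 t θ (RobustRIPr.Q₁ F.μ ε (F.p t) (F.p θ))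
  have e := Q₁_eq_withDensity hε hε1 t θ hlu
  rw [e] at h1 hint ⊢
  exact klDiv_withDensity (measurable_truncRatio_p ε t θ)
    (fun x => (truncRatio_pos (F.lower_spec t θ hε hε1).1 x).le) hint

/-- The divergence is the `Q₁`-mean of `log π`, whose values lie in `[log c', log c'']`. Passing
from `Q₁` to `Q` through `P_θ` costs at most `2 ε` times the length of this interval. -/
theorem klDiv_sub_le_rate {Θ₀ : Set ℝ} {θ t : ℝ} (hd : F.riprDensity Θ₀ θ = F.p t)
    {ε : ℝ} (hε : 0 < ε) (hε1 : ε < 1) (hlu : F.cLower Θ₀ ε θ < F.cUpper Θ₀ ε θ)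
    (hQ : Q ∈ contaminationBall ε (F.P θ) ∨ Q ∈ tvBall ε (F.P θ)) :
    InformationTheory.klDiv (F.Q₁ Θ₀ ε θ) (F.Q₀ Θ₀ ε θ) ≠ ∞ ∧
      (InformationTheory.klDiv (F.Q₁ Θ₀ ε θ) (F.Q₀ Θ₀ ε θ)).toReal
          - 2 * (Real.log (F.cUpper Θ₀ ε θ) - Real.log (F.cLower Θ₀ ε θ)) * ε
          - Real.log (F.normConst Θ₀ ε θ)
        ≤ F.rate Θ₀ ε θ Q := by
  rw [cLower, cUpper, hd] at hlu
  rw [Q₁, Q₀, cUpper, cLower, normConst, rate, growthRate, hd]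
  obtain ⟨h1, h2⟩ := klDiv_Q₁_Q₀ hε hε1 t θ hlu
  refine ⟨h1, ?_⟩
  rw [h2]
  have hP := isProbabilityMeasure_Q₁ (F := F) hε hε1 t θ
  obtain ⟨hQp, hQ'⟩ := abs_real_sub_real_le_of_mem hε hε1 hQ
  have hll := Real.log_le_log (F.lower_spec t θ hε hε1).1 hlu.le
  have := integral_sub_integral_le (P := RobustRIPr.Q₁ F.μ ε (F.p t) (F.p θ)) (Q := Q)
    (ε := 2 * ε) (measurable_log_truncRatio ε t θ) hll
    (fun x => (log_truncRatio_mem hε hε1 t θ x).1)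
    (fun x => (log_truncRatio_mem hε hε1 t θ x).2.trans_eq (max_eq_right hll)) fun S hS => by
      have h3 := abs_le.1 (hQ' S hS)
      have h4 := abs_le.1 (P_real_sub_Q₁_real_le (F := F) hε hε1 t θ hS)
      linarith [h3.2, h4.1]
  linarith

end ExpFamily

/-- If the masses agree, the nonnegative function `max (f, c g) - f` has integral zero. This locates
the limits of the thresholds as `ε ↓ 0`. -/
theorem ae_mul_le_or_lt_maxMass {μ : Measure 𝒳} {f g : 𝒳 → ℝ} (hf : Integrable f μ)
    (hg : Integrable g μ) (c : ℝ) :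
    (∀ᵐ x ∂μ, c * g x ≤ f x) ∨ ∫ x, f x ∂μ < maxMass μ f g c := by
  rcases (le_maxMass hf hg c).eq_or_lt with h | h
  · left
    have h0 : 0 ≤ fun x => max (f x) (c * g x) - f x := fun x => sub_nonneg.2 (le_max_left _ _)
    have h1 : ∫ x, (max (f x) (c * g x) - f x) ∂μ = 0 := by
      rw [integral_sub (integrable_max_mul hf hg c) hf, h, maxMass, sub_self]
    filter_upwards [(integral_eq_zero_iff_of_nonneg h0
      ((integrable_max_mul hf hg c).sub hf)).1 h1] with x hx
    have h2 := le_max_right (f x) (c * g x)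
    simp only [Pi.zero_apply] at hx
    linarith
  · exact Or.inr h

namespace ExpFamily

variable {F : ExpFamily 𝒳}

/-! ### Vanishing contamination -/

/-- From `c ≤ ∫ max (p_θ, c p_t) ≤ 1 + c`, where the integral equals `(1 - ε)⁻¹ ≥ 1 + ε`. -/
theorem lower_bounds (t θ : ℝ) {ε : ℝ} (hε : 0 < ε) (hε1 : ε < 1) :
    ε ≤ lowerThreshold F.μ ε (F.p t) (F.p θ) ∧
      lowerThreshold F.μ ε (F.p t) (F.p θ) ≤ (1 - ε)⁻¹ := by
  obtain ⟨h1, h2⟩ := F.lower_spec t θ hε hε1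
  have he : 1 + ε ≤ (1 - ε)⁻¹ := by
    rw [le_inv_comm₀ (by linarith) (by linarith), inv_eq_one_div, le_div_iff₀ (by linarith)]
    nlinarith
  have h3 := maxMass_le (F.integrable_dens θ) (F.integrable_dens t) (F.dens_nonneg θ)
    (F.dens_nonneg t) h1.le
  have h4 := mul_le_maxMass (F.integrable_dens θ) (F.integrable_dens t)
    (lowerThreshold F.μ ε (F.p t) (F.p θ))
  rw [integral_dens] at h4
  rw [integral_dens, integral_dens] at h3
  constructor <;> linarith

theorem upper_bounds (t θ : ℝ) {ε : ℝ} (hε : 0 < ε) (hε1 : ε < 1) :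
    1 - ε ≤ upperThreshold F.μ ε (F.p t) (F.p θ) ∧
      upperThreshold F.μ ε (F.p t) (F.p θ) ≤ ε⁻¹ := by
  obtain ⟨h1, h2⟩ := F.upper_spec t θ hε hε1
  have he : 1 + ε ≤ (1 - ε)⁻¹ := by
    rw [le_inv_comm₀ (by linarith) (by linarith), inv_eq_one_div, le_div_iff₀ (by linarith)]
    nlinarith
  have h3 := maxMass_le (F.integrable_dens t) (F.integrable_dens θ) (F.dens_nonneg t)
    (F.dens_nonneg θ) (inv_pos.2 h1).le
  have h4 := mul_le_maxMass (F.integrable_dens t) (F.integrable_dens θ)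
    (upperThreshold F.μ ε (F.p t) (F.p θ))⁻¹
  rw [integral_dens] at h4
  rw [integral_dens, integral_dens] at h3
  constructor
  · rw [h2, mul_one] at h4
    exact (inv_le_inv₀ h1 (by linarith)).1 h4
  · rw [le_inv_comm₀ h1 hε]
    linarith

/-- The bound `c'' ≤ 1/ε` only keeps `c'' ε` bounded; convergence to zero needs a second moment. The
square of `p_θ/p_t` is `P_t`-integrable because `2θ - t` is again a parameter, and `max (1, r/u) ≤ 1
+ (r/u)²`. -/
theorem exists_mul_upper_sq_le (t θ : ℝ) : ∃ K, ∀ ε, 0 < ε → ε < 1 →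
    ε * upperThreshold F.μ ε (F.p t) (F.p θ) ^ 2 ≤ K := by
  set K := Real.exp (F.A t - F.A θ + (F.A (2 * θ - t) - F.A θ)) with hK
  have hsq : ∀ x, F.dens t x * Real.exp (F.logRatio θ t x) ^ 2 = K * F.dens (2 * θ - t) x := by
    intro x
    rw [F.dens_eq_mul_exp (2 * θ - t) t, sq, ← Real.exp_add, hK, mul_left_comm, ← Real.exp_add,
      logRatio, logRatio]
    ring_nf
  refine ⟨K, fun ε hε hε1 => ?_⟩
  obtain ⟨h1, h2⟩ := F.upper_spec t θ hε hε1
  set u := upperThreshold F.μ ε (F.p t) (F.p θ)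
  have h3 : maxMass F.μ (F.dens t) (F.dens θ) u⁻¹ ≤ 1 + u⁻¹ ^ 2 * K := by
    have e : 1 + u⁻¹ ^ 2 * K = ∫ x, (F.dens t x + u⁻¹ ^ 2 * (K * F.dens (2 * θ - t) x)) ∂F.μ := by
      rw [integral_add (F.integrable_dens t) (((F.integrable_dens _).const_mul _).const_mul _),
        integral_const_mul, integral_const_mul, integral_dens, integral_dens, mul_one]
    rw [e]
    refine integral_mono (integrable_max_mul (F.integrable_dens t) (F.integrable_dens θ) _)
      ((F.integrable_dens t).add (((F.integrable_dens _).const_mul _).const_mul _)) fun x => ?_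
    simp only
    rw [← hsq, F.dens_eq_mul_exp θ t]
    have hd := F.dens_nonneg t x
    set r := Real.exp (F.logRatio θ t x)
    refine max_le ?_ ?_
    · have : 0 ≤ u⁻¹ ^ 2 * (F.dens t x * r ^ 2) := by positivity
      linarith
    -- With `y = r/u`, this is `(y - 1)² + y ≥ 0`, that is, `y ≤ 1 + y²`.
    · have : 0 ≤ F.dens t x * ((u⁻¹ * r - 1) ^ 2 + u⁻¹ * r) := by positivity
      nlinarith
  rw [h2] at h3
  have he : 1 + ε ≤ (1 - ε)⁻¹ := by
    rw [le_inv_comm₀ (by linarith) (by linarith), inv_eq_one_div, le_div_iff₀ (by linarith)]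
    nlinarith
  have h4 : ε ≤ u⁻¹ ^ 2 * K := by linarith
  rw [inv_pow, le_inv_mul_iff₀ (by positivity)] at h4
  linarith

theorem tendsto_mul_upper (t θ : ℝ) :
    Tendsto (fun ε => upperThreshold F.μ ε (F.p t) (F.p θ) * ε) (𝓝[>] 0) (𝓝 0) := by
  obtain ⟨K, hK⟩ := exists_mul_upper_sq_le (F := F) t θ
  have hs : Tendsto (fun ε : ℝ => √(K * ε)) (𝓝[>] 0) (𝓝 0) := by
    have : Continuous fun ε : ℝ => √(K * ε) := by fun_prop
    simpa using (this.tendsto 0).mono_left nhdsWithin_le_nhds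
  have hev : ∀ᶠ ε : ℝ in 𝓝[>] 0, 0 < ε ∧ ε < 1 := by
    filter_upwards [Ioo_mem_nhdsGT one_pos] with ε hε using hε
  refine tendsto_of_tendsto_of_tendsto_of_le_of_le' tendsto_const_nhds hs ?_ ?_
  · filter_upwards [hev] with ε hε
    exact mul_nonneg (F.upper_spec t θ hε.1 hε.2).1.le hε.1.le
  · filter_upwards [hev] with ε hε
    refine Real.le_sqrt_of_sq_le ?_
    have := mul_le_mul_of_nonneg_right (hK ε hε.1 hε.2) hε.1.le
    linarith

/-- Below, `p_t π ≥ min (u p_t, p_θ)`, and the minimum is the sum minus the maximum, whose mass is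
known. Above, `p_t π ≤ max (p_θ, c' p_t)`. -/
theorem integral_truncRatio_bounds (t θ : ℝ) {ε : ℝ} (hε : 0 < ε) (hε1 : ε < 1) :
    1 + upperThreshold F.μ ε (F.p t) (F.p θ)
        - upperThreshold F.μ ε (F.p t) (F.p θ) * (1 - ε)⁻¹
      ≤ ∫ x, truncRatio F.μ ε (F.p t) (F.p θ) x ∂F.P t ∧
    ∫ x, truncRatio F.μ ε (F.p t) (F.p θ) x ∂F.P t ≤ (1 - ε)⁻¹ := by
  obtain ⟨h1, h2⟩ := F.upper_spec t θ hε hε1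
  obtain ⟨h3, h4⟩ := F.lower_spec t θ hε hε1
  have hi := (F.integrable_P_iff t).1 (integrable_truncRatio (F := F) hε hε1 t θ (F.P t))
  rw [integral_P]
  have hr : ∀ x, F.dens t x * F.ratio θ t x = F.dens θ x := fun x => by
    rw [ratio]
    split_ifs with h
    · simp [dens, h]
    · exact (F.dens_eq_mul_exp θ t x).symm
  set u := upperThreshold F.μ ε (F.p t) (F.p θ)
  set l := lowerThreshold F.μ ε (F.p t) (F.p θ)
  constructor
  · have hadd : Integrable (fun x => F.dens θ x + u * F.dens t x) F.μ :=
      (F.integrable_dens θ).add ((F.integrable_dens t).const_mul u)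
    have e : 1 + u - u * (1 - ε)⁻¹ = ∫ x, (F.dens θ x + u * F.dens t x
        - u * max (F.dens t x) (u⁻¹ * F.dens θ x)) ∂F.μ := by
      rw [integral_sub hadd
        ((integrable_max_mul (F.integrable_dens t) (F.integrable_dens θ) _).const_mul u),
        integral_add (F.integrable_dens θ) ((F.integrable_dens t).const_mul u),
        integral_const_mul, integral_const_mul, integral_dens, integral_dens, ← h2, maxMass, mul_one]
    rw [e]
    refine integral_mono (hadd.sub
      ((integrable_max_mul (F.integrable_dens t) (F.integrable_dens θ) _).const_mul u)) hi
      fun x => ?_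
    simp only
    rw [truncRatio_eq hε hε1]
    have hm := mul_le_mul_of_nonneg_left (le_max_right l (min u (F.ratio θ t x)))
      (F.dens_nonneg t x)
    refine le_trans ?_ hm
    rw [mul_min_of_nonneg _ _ (F.dens_nonneg t x), hr]
    have h5 := mul_le_mul_of_nonneg_left (le_max_left (F.dens t x) (u⁻¹ * F.dens θ x)) h1.le
    have h6 := mul_le_mul_of_nonneg_left (le_max_right (F.dens t x) (u⁻¹ * F.dens θ x)) h1.le
    rw [mul_inv_cancel_left₀ h1.ne'] at h6
    exact le_min (by linarith) (by linarith)
  · rw [← h4]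
    refine integral_mono hi (integrable_max_mul (F.integrable_dens θ) (F.integrable_dens t) _)
      fun x => ?_
    simp only
    rw [truncRatio_eq hε hε1, mul_max_of_nonneg _ _ (F.dens_nonneg t x)]
    refine max_le ((mul_comm _ _).trans_le (le_max_right _ _)) (le_max_of_le_left ?_)
    exact (mul_le_mul_of_nonneg_left (min_le_right _ _) (F.dens_nonneg t x)).trans_eq (hr x)

theorem eventually_mem_Ioo {a : ℝ} (ha : 0 < a) : ∀ᶠ ε : ℝ in 𝓝[>] 0, 0 < ε ∧ ε < a := by
  filter_upwards [Ioo_mem_nhdsGT ha] with ε hε using hε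

theorem tendsto_one_sub_inv : Tendsto (fun ε : ℝ => (1 - ε)⁻¹) (𝓝[>] 0) (𝓝 1) := by
  have : ContinuousAt (fun ε : ℝ => (1 - ε)⁻¹) 0 := by
    refine ContinuousAt.inv₀ (by fun_prop) (by norm_num)
  simpa using this.tendsto.mono_left nhdsWithin_le_nhds

theorem tendsto_normalizer {Θ₀ : Set ℝ} {s θ t : ℝ} (h : Separates Θ₀ s θ) (ht : t ∈ Θ₀)
    (hP : F.P t = F.P s) :
    Tendsto (fun ε => normalizer F.μ (F.family Θ₀) ε (F.p t) (F.p θ)) (𝓝[>] 0) (𝓝 1) := by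
  have hu := tendsto_mul_upper (F := F) t θ
  have hinv := tendsto_one_sub_inv
  have hid : Tendsto (fun ε : ℝ => ε) (𝓝[>] 0) (𝓝 0) :=
    (tendsto_id (x := 𝓝 (0 : ℝ))).mono_left nhdsWithin_le_nhds
  have hl : Tendsto (fun ε => lowerThreshold F.μ ε (F.p t) (F.p θ) * ε) (𝓝[>] 0) (𝓝 0) := by
    have h1 : Tendsto (fun ε : ℝ => (1 - ε)⁻¹ * ε) (𝓝[>] 0) (𝓝 0) := by
      simpa using hinv.mul hid
    refine tendsto_of_tendsto_of_tendsto_of_le_of_le' tendsto_const_nhds h1 ?_ ?_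
    · filter_upwards [eventually_mem_Ioo one_pos] with ε hε
      exact mul_nonneg (F.lower_spec t θ hε.1 hε.2).1.le hε.1.le
    · filter_upwards [eventually_mem_Ioo one_pos] with ε hε
      exact mul_le_mul_of_nonneg_right (lower_bounds t θ hε.1 hε.2).2 hε.1.le
  have hE : Tendsto (fun ε => ∫ x, truncRatio F.μ ε (F.p t) (F.p θ) x ∂F.P t) (𝓝[>] 0) (𝓝 1) := by
    have h1 : Tendsto (fun ε => 1 - upperThreshold F.μ ε (F.p t) (F.p θ) * ε * (1 - ε)⁻¹)
        (𝓝[>] 0) (𝓝 1) := by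
      simpa using (hu.mul hinv).const_sub 1
    refine tendsto_of_tendsto_of_tendsto_of_le_of_le' h1 hinv ?_ ?_
    · filter_upwards [eventually_mem_Ioo one_pos] with ε hε
      refine le_trans (le_of_eq ?_) (integral_truncRatio_bounds t θ hε.1 hε.2).1
      have : 1 - ε ≠ 0 := by linarith [hε.2]
      field_simp
      ring
    · filter_upwards [eventually_mem_Ioo one_pos] with ε hε
      exact (integral_truncRatio_bounds t θ hε.1 hε.2).2
  have := hE.add (hu.sub hl)
  rw [sub_zero, add_zero] at this
  refine this.congr' ?_
  filter_upwards [eventually_mem_Ioo one_pos] with ε hε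
  rw [normalizer_eq h ht hε.1 hε.2, hP, sub_mul]

/-- `c'` need not tend to `0` when the likelihood ratio is bounded below. Each rational level is
either an almost sure lower bound of the log ratio or eventually exceeds `log c'`, since `(1 - ε)⁻¹
→ 1`. Rational levels leave a single null set. -/
theorem ae_eventually_log_lower_le (t θ : ℝ) : ∀ᵐ x ∂F.P θ, ∀ η > 0,
    ∀ᶠ ε in 𝓝[>] 0,
      Real.log (lowerThreshold F.μ ε (F.p t) (F.p θ)) ≤ F.logRatio θ t x + η := by
  have key : ∀ q : ℚ, (∀ᵐ x ∂F.P θ, (q : ℝ) ≤ F.logRatio θ t x) ∨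
      ∀ᶠ ε in 𝓝[>] 0, Real.log (lowerThreshold F.μ ε (F.p t) (F.p θ)) < q := by
    intro q
    rcases ae_mul_le_or_lt_maxMass (F.integrable_dens θ) (F.integrable_dens t) (Real.exp q)
      with h | h
    · left
      filter_upwards [(withDensity_absolutelyContinuous F.μ (F.p θ)).ae_le h, F.ae_h_ne_zero θ]
        with x hx hh
      have hpos : 0 < F.dens t x :=
        mul_pos (lt_of_le_of_ne (F.h_nonneg x) (Ne.symm hh)) (Real.exp_pos _)
      rw [F.dens_eq_mul_exp θ t, mul_comm] at hx
      exact Real.exp_le_exp.1 (le_of_mul_le_mul_left hx hpos)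
    · right
      rw [integral_dens] at h
      filter_upwards [tendsto_one_sub_inv.eventually_lt_const h, eventually_mem_Ioo one_pos]
        with ε h1 h2
      obtain ⟨h3, h4⟩ := F.lower_spec t θ h2.1 h2.2
      rw [← h4] at h1
      rw [Real.log_lt_iff_lt_exp h3]
      exact lt_of_maxMass_lt (F.integrable_dens θ) (F.integrable_dens t) (F.dens_nonneg t) h1
  have hall : ∀ᵐ x ∂F.P θ, ∀ q : ℚ, (q : ℝ) ≤ F.logRatio θ t x ∨
      ∀ᶠ ε in 𝓝[>] 0, Real.log (lowerThreshold F.μ ε (F.p t) (F.p θ)) < q := by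
    refine ae_all_iff.2 fun q => ?_
    rcases key q with h | h
    · filter_upwards [h] with x hx using Or.inl hx
    · exact ae_of_all _ fun x => Or.inr h
  filter_upwards [hall] with x hx η hη
  -- A rational just above the log ratio at `x` cannot be a lower bound there, so the second
  -- alternative holds.
  obtain ⟨q, hq1, hq2⟩ := exists_rat_btwn (lt_add_of_pos_right (F.logRatio θ t x) hη)
  filter_upwards [(hx q).resolve_left (not_le.2 hq1)] with ε hε
  exact (hε.trans hq2).le

theorem ae_eventually_le_log_upper (t θ : ℝ) : ∀ᵐ x ∂F.P θ, ∀ η > 0,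
    ∀ᶠ ε in 𝓝[>] 0,
      F.logRatio θ t x - η ≤ Real.log (upperThreshold F.μ ε (F.p t) (F.p θ)) := by
  have key : ∀ q : ℚ, (∀ᵐ x ∂F.P θ, F.logRatio θ t x ≤ q) ∨
      ∀ᶠ ε in 𝓝[>] 0, (q : ℝ) < Real.log (upperThreshold F.μ ε (F.p t) (F.p θ)) := by
    intro q
    rcases ae_mul_le_or_lt_maxMass (F.integrable_dens t) (F.integrable_dens θ) (Real.exp (-q))
      with h | h
    · left
      filter_upwards [(withDensity_absolutelyContinuous F.μ (F.p θ)).ae_le h, F.ae_h_ne_zero θ]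
        with x hx hh
      have hpos : 0 < F.dens t x :=
        mul_pos (lt_of_le_of_ne (F.h_nonneg x) (Ne.symm hh)) (Real.exp_pos _)
      rw [F.dens_eq_mul_exp θ t, mul_left_comm, ← Real.exp_add] at hx
      have h1 : Real.exp (-q + F.logRatio θ t x) ≤ 1 := le_of_mul_le_mul_left (by linarith) hpos
      linarith [Real.exp_le_one_iff.1 h1]
    · right
      rw [integral_dens] at h
      filter_upwards [tendsto_one_sub_inv.eventually_lt_const h, eventually_mem_Ioo one_pos]
        with ε h1 h2
      obtain ⟨h3, h4⟩ := F.upper_spec t θ h2.1 h2.2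
      rw [← h4] at h1
      rw [Real.lt_log_iff_exp_lt h3]
      have := lt_of_maxMass_lt (F.integrable_dens t) (F.integrable_dens θ) (F.dens_nonneg θ) h1
      rw [Real.exp_neg] at this
      exact (inv_lt_inv₀ h3 (Real.exp_pos _)).1 this
  have hall : ∀ᵐ x ∂F.P θ, ∀ q : ℚ, F.logRatio θ t x ≤ q ∨
      ∀ᶠ ε in 𝓝[>] 0, (q : ℝ) < Real.log (upperThreshold F.μ ε (F.p t) (F.p θ)) := by
    refine ae_all_iff.2 fun q => ?_
    rcases key q with h | h
    · filter_upwards [h] with x hx using Or.inl hx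
    · exact ae_of_all _ fun x => Or.inr h
  filter_upwards [hall] with x hx η hη
  obtain ⟨q, hq1, hq2⟩ := exists_rat_btwn (sub_lt_self (F.logRatio θ t x) hη)
  filter_upwards [(hx q).resolve_left (not_le.2 hq2)] with ε hε
  exact (hq1.trans hε).le

/-- For `ε < 1/2`, `c' ≤ 2` and `c'' ≥ 1/2`, so truncation raises the absolute log ratio by at most
`log 2`; this gives the dominating function. -/
theorem tendsto_integral_log_truncRatio (t θ : ℝ) :
    Tendsto (fun ε => ∫ x, Real.log (truncRatio F.μ ε (F.p t) (F.p θ) x) ∂F.P θ) (𝓝[>] 0)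
      (𝓝 (∫ x, F.logRatio θ t x ∂F.P θ)) := by
  refine tendsto_integral_filter_of_dominated_convergence
    (fun x => |F.logRatio θ t x| + Real.log 2)
    (Eventually.of_forall fun ε => (measurable_log_truncRatio ε t θ).aestronglyMeasurable) ?_
    ((F.integrable_logRatio θ t θ).abs.add (integrable_const _)) ?_
  · filter_upwards [eventually_mem_Ioo one_half_pos] with ε hε
    have hε1 : ε < 1 := hε.2.trans one_half_lt_one
    have hl : Real.log (lowerThreshold F.μ ε (F.p t) (F.p θ)) ≤ Real.log 2 := by
      refine Real.log_le_log (F.lower_spec t θ hε.1 hε1).1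
        ((lower_bounds t θ hε.1 hε1).2.trans ?_)
      rw [inv_le_comm₀ (by linarith) two_pos]
      linarith [hε.2]
    have hu : -Real.log 2 ≤ Real.log (upperThreshold F.μ ε (F.p t) (F.p θ)) := by
      rw [← Real.log_inv]
      refine Real.log_le_log (by norm_num) (le_trans ?_ (upper_bounds t θ hε.1 hε1).1)
      linarith [hε.2]
    have h2 : 0 ≤ Real.log 2 := Real.log_nonneg one_le_two
    filter_upwards [F.ae_h_ne_zero θ] with x hx
    rw [log_truncRatio_of_ne hε.1 hε1 _ _ hx, Real.norm_eq_abs, abs_le]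
    have h3 := neg_abs_le (F.logRatio θ t x)
    have h4 := le_abs_self (F.logRatio θ t x)
    have h5 := abs_nonneg (F.logRatio θ t x)
    constructor
    · exact le_max_of_le_right (le_min (by linarith) (by linarith))
    · exact max_le (by linarith) ((min_le_right _ _).trans (by linarith))
  · filter_upwards [F.ae_h_ne_zero θ, ae_eventually_log_lower_le t θ,
      ae_eventually_le_log_upper t θ] with x hx h1 h2
    refine Metric.tendsto_nhds.2 fun η hη => ?_
    filter_upwards [eventually_mem_Ioo one_pos, h1 _ (half_pos hη), h2 _ (half_pos hη)]
      with ε hε h3 h4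
    rw [log_truncRatio_of_ne hε.1 hε.2 _ _ hx, Real.dist_eq, abs_lt]
    have h5 : F.logRatio θ t x - η / 2 ≤
        max (Real.log (lowerThreshold F.μ ε (F.p t) (F.p θ)))
        (min (Real.log (upperThreshold F.μ ε (F.p t) (F.p θ))) (F.logRatio θ t x)) :=
      le_max_of_le_right (le_min h4 (by linarith))
    have h6 : max (Real.log (lowerThreshold F.μ ε (F.p t) (F.p θ)))
        (min (Real.log (upperThreshold F.μ ε (F.p t) (F.p θ))) (F.logRatio θ t x))
        ≤ F.logRatio θ t x + η / 2 :=
      max_le h3 ((min_le_right _ _).trans (by linarith))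
    constructor <;> linarith

theorem abs_integral_log_truncRatio_sub_le (t θ : ℝ) {ε : ℝ} (hε : 0 < ε) (hε1 : ε < 1)
    {Q : Measure 𝒳} (hQ : Q ∈ contaminationBall ε (F.P θ) ∨ Q ∈ tvBall ε (F.P θ)) :
    |∫ x, Real.log (truncRatio F.μ ε (F.p t) (F.p θ) x) ∂Q
      - ∫ x, Real.log (truncRatio F.μ ε (F.p t) (F.p θ) x) ∂F.P θ| ≤ -2 * (Real.log ε * ε) := by
  obtain ⟨hQp, hQ'⟩ := abs_real_sub_real_le_of_mem hε hε1 hQ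
  have hl : Real.log ε ≤ Real.log (lowerThreshold F.μ ε (F.p t) (F.p θ)) :=
    Real.log_le_log hε (lower_bounds t θ hε hε1).1
  have hu : Real.log (upperThreshold F.μ ε (F.p t) (F.p θ)) ≤ -Real.log ε := by
    rw [← Real.log_inv]
    exact Real.log_le_log (F.upper_spec t θ hε hε1).1 (upper_bounds t θ hε hε1).2
  have hε0 : Real.log ε < 0 := Real.log_neg hε hε1
  set l := Real.log (lowerThreshold F.μ ε (F.p t) (F.p θ)) with hl'
  set u := Real.log (upperThreshold F.μ ε (F.p t) (F.p θ))
  -- The order of the thresholds is not assumed here, hence `max l u`; both logarithms lie in the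
  -- range allowed by `ε ≤ c'`, `c'' ≤ 1/ε`.
  have hb : (max l u - l) * ε ≤ -2 * (Real.log ε * ε) := by
    have : max l u - l ≤ -2 * Real.log ε := by
      rw [sub_le_iff_le_add]
      exact max_le (by linarith) (by linarith)
    nlinarith
  have h1 := integral_sub_integral_le (P := Q) (Q := F.P θ) (ε := ε)
    (measurable_log_truncRatio ε t θ) (le_max_left l u)
    (fun x => (log_truncRatio_mem hε hε1 t θ x).1)
    (fun x => (log_truncRatio_mem hε hε1 t θ x).2)
    fun S hS => by linarith [(abs_le.1 (hQ' S hS)).1]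
  have h2 := integral_sub_integral_le (P := F.P θ) (Q := Q) (ε := ε)
    (measurable_log_truncRatio ε t θ) (le_max_left l u)
    (fun x => (log_truncRatio_mem hε hε1 t θ x).1)
    (fun x => (log_truncRatio_mem hε hε1 t θ x).2)
    fun S hS => (abs_le.1 (hQ' S hS)).2
  rw [abs_le]
  constructor <;> linarith

theorem klDiv_P_P (θ t : ℝ) : InformationTheory.klDiv (F.P θ) (F.P t) ≠ ∞ ∧
    (InformationTheory.klDiv (F.P θ) (F.P t)).toReal = ∫ x, F.logRatio θ t x ∂F.P θ := by
  have e := F.P_eq_withDensity θ t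
  have h1 := F.isProbabilityMeasure_P θ
  have hint := F.integrable_logRatio θ t θ
  rw [e] at h1 hint ⊢
  have := klDiv_withDensity (R := F.P t) (f := fun x => Real.exp (F.logRatio θ t x))
    (Real.measurable_exp.comp (F.measurable_logRatio θ t))
    (fun x => (Real.exp_pos _).le) (by simpa only [Real.log_exp] using hint)
  simpa only [Real.log_exp] using this

theorem tendsto_rate {Θ₀ : Set ℝ} {s θ t : ℝ} (h : Separates Θ₀ s θ) (ht : t ∈ Θ₀)
    (hd : F.riprDensity Θ₀ θ = F.p t) (hP : F.P t = F.P s) {Q : ℝ → Measure 𝒳}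
    (hQ : ∀ ε, 0 < ε → ε < 1 →
      Q ε ∈ contaminationBall ε (F.P θ) ∨ Q ε ∈ tvBall ε (F.P θ)) :
    Tendsto (fun ε => F.rate Θ₀ ε θ (Q ε)) (𝓝[>] 0)
      (𝓝 (InformationTheory.klDiv (F.P θ) (F.P t)).toReal) := by
  rw [(klDiv_P_P θ t).2]
  simp only [rate, growthRate, hd]
  have hN := (tendsto_normalizer h ht hP).log one_ne_zero
  rw [Real.log_one] at hN
  have h0 : Tendsto (fun ε => -2 * (Real.log ε * ε)) (𝓝[>] 0) (𝓝 0) := by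
    have := (tendsto_log_mul_rpow_nhdsGT_zero one_pos).const_mul (-2)
    simpa only [Real.rpow_one, mul_zero] using this
  have hdiff : Tendsto (fun ε => ∫ x, Real.log (truncRatio F.μ ε (F.p t) (F.p θ) x) ∂Q ε
      - ∫ x, Real.log (truncRatio F.μ ε (F.p t) (F.p θ) x) ∂F.P θ) (𝓝[>] 0) (𝓝 0) := by
    refine squeeze_zero_norm' ?_ h0
    filter_upwards [eventually_mem_Ioo one_pos] with ε hε
    rw [Real.norm_eq_abs]
    exact abs_integral_log_truncRatio_sub_le (F := F) t θ hε.1 hε.2 (hQ ε hε.1 hε.2)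
  have := (hdiff.add (tendsto_integral_log_truncRatio (F := F) t θ)).sub hN
  simpa only [sub_add_cancel, zero_add, sub_zero] using this

end ExpFamily

end RobustRIPr

end

theorem mainTheorem11 {𝒳 : Type*} [MeasurableSpace 𝒳]
    (F : RobustRIPr.ExpFamily 𝒳)
    (hconv : ConvexOn ℝ Set.univ F.A) (hdiff : Differentiable ℝ F.A)
    (Θ₀ Θ₁ : Set ℝ) (hdisj : Disjoint Θ₀ Θ₁)
    (θ₁ : ℝ) (hθ₁ : θ₁ ∈ Θ₁)
    (hθs : (∃ θs, IsLeast Θ₀ θs ∧ θ₁ < θs) ∨ (∃ θs, IsGreatest Θ₀ θs ∧ θs < θ₁)) :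
    -- `P₀ = F.ripr Θ₀ θ₁` is the reverse information projection of `P₁ = F.P θ₁`
    RobustRIPr.IsRIPr (F.family Θ₀) (F.P θ₁) (F.ripr Θ₀ θ₁) ∧
    -- almost sure growth rate of both tests, and the lower bound, for fixed `ε`
    (∀ ε : ℝ, 0 < ε → ε < 1 → F.cLower Θ₀ ε θ₁ < F.cUpper Θ₀ ε θ₁ →
      ∀ Q : Measure 𝒳,
        (Q ∈ RobustRIPr.contaminationBall ε (F.P θ₁) ∨ Q ∈ RobustRIPr.tvBall ε (F.P θ₁)) →
        (∀ (Ω : Type*) [MeasurableSpace Ω] (ν : Measure Ω) [IsProbabilityMeasure ν]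
            (X : ℕ → Ω → 𝒳) (θhat : (i : ℕ) → (Fin i → 𝒳) → ℝ),
          (∀ i, Measurable (X i)) → iIndepFun X ν → (∀ i, ν.map (X i) = Q) →
          (∀ i, Measurable (θhat i)) → (∀ i y, θhat i y ∈ Θ₁) →
          (∀ᵐ ω ∂ν, Tendsto (fun n => θhat n (fun j => X j ω)) atTop (𝓝 θ₁)) →
          (∀ᵐ ω ∂ν, Tendsto
            (fun n : ℕ => (1 / (n : ℝ)) *
              Real.log (F.plugInWealth Θ₀ ε θhat (fun i => X i ω) n))
            atTop (𝓝 (F.rate Θ₀ ε θ₁ Q))) ∧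
          (∀ᵐ ω ∂ν, Tendsto
            (fun n : ℕ => (1 / (n : ℝ)) *
              Real.log (F.riprWealth Θ₀ ε θ₁ (fun i => X i ω) n))
            atTop (𝓝 (F.rate Θ₀ ε θ₁ Q)))) ∧
        InformationTheory.klDiv (F.Q₁ Θ₀ ε θ₁) (F.Q₀ Θ₀ ε θ₁) ≠ ∞ ∧
        (InformationTheory.klDiv (F.Q₁ Θ₀ ε θ₁) (F.Q₀ Θ₀ ε θ₁)).toReal
            - 2 * (Real.log (F.cUpper Θ₀ ε θ₁) - Real.log (F.cLower Θ₀ ε θ₁)) * ε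
            - Real.log (F.normConst Θ₀ ε θ₁)
          ≤ F.rate Θ₀ ε θ₁ Q) ∧
    -- the limit as `ε ↓ 0`
    InformationTheory.klDiv (F.P θ₁) (F.ripr Θ₀ θ₁) ≠ ∞ ∧
    (∀ Q : ℝ → Measure 𝒳,
      (∀ ε, 0 < ε → ε < 1 →
        Q ε ∈ RobustRIPr.contaminationBall ε (F.P θ₁) ∨ Q ε ∈ RobustRIPr.tvBall ε (F.P θ₁)) →
      Tendsto (fun ε => F.rate Θ₀ ε θ₁ (Q ε)) (𝓝[>] 0)
        (𝓝 (InformationTheory.klDiv (F.P θ₁) (F.ripr Θ₀ θ₁)).toReal)) := by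
  obtain ⟨s, hs⟩ := RobustRIPr.ExpFamily.separates_of_extremal hθs
  have hA : Continuous F.A := hdiff.continuous
  obtain ⟨t, ht, hd, hP, hR⟩ := RobustRIPr.ExpFamily.riprDensity_spec hconv hs
  have hripr : F.ripr Θ₀ θ₁ = F.P t := by
    rw [RobustRIPr.ExpFamily.ripr, hd, RobustRIPr.ExpFamily.P]
  rw [hripr]
  refine ⟨hR, fun ε hε hε1 hlu Q hQ => ?_, (RobustRIPr.ExpFamily.klDiv_P_P θ₁ t).1,
    fun Q hQ => RobustRIPr.ExpFamily.tendsto_rate hs ht hd hP hQ⟩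
  obtain ⟨hQp, -⟩ := RobustRIPr.abs_real_sub_real_le_of_mem hε hε1 hQ
  refine ⟨fun Ω _ ν _ X θhat hX hind hmap _ _ hθ => ⟨?_, ?_⟩,
    RobustRIPr.ExpFamily.klDiv_sub_le_rate hd hε hε1 hlu hQ⟩
  · exact RobustRIPr.ExpFamily.tendsto_log_plugInWealth hconv hA hs hε hε1 hlu hX hind hmap hθ
  · exact RobustRIPr.ExpFamily.tendsto_log_riprWealth ⟨s, hs.1⟩ hd hε hε1 hlu hX hind hmap
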